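/- **Definitions.** An $s$-$t$ graph is a graph with two distinguished vertices $s,t$; a metric one carries edge lengths $\mathsf{len}\ge 0$ and the shortest-path metric $d$. For metric $s$-$t$ graphs $H,G$ let $H\oslash G$ be obtained by replacing each edge $e=(u,v)$ of $H$ (with an arbitrary orientation) by a copy of $G$, with $s(G)$ identified with $u$ and $t(G)$ with $v$, all lengths in that copy being multiplied by $\mathsf{len}(e)/d_G(s(G),t(G))$; put $s(H\oslash G)=s(H)$, $t(H\oslash G)=t(H)$. Let $G^{\oslash 0}$ be a single edge $(s,t)$ of unit length and $G^{\oslash k}=G^{\oslash (k-1)}\oslash G$. For a finite graph $G=(V,E)$ of diameter $D$, let $\vec G$ be the metric $s$-$t$ graph with vertices $s',t'$ and $v^{(i)}$ ($v\in V$, $1\le i\le D+1$), whose edges are $(s',v^{(1)})$ and $(v^{(D+1)},t')$ for $v\in V$, of length $D$, and, of length $1$, the edges $(u^{(j)},v^{(j)})$ for $\{u,v\}\in E$, $j\le D+1$, the edges $(u^{(i)},v^{(i+1)})$ for all ordered pairs $(u,v)$ with $\{u,v\}\in E$, $i\le D$, and the edges $(v^{(i)},v^{(i+1)})$ for $v\in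 V$, $i\le D$. Let $\widetilde G$ be $\vec G$ with two new vertices $s,t$ (the distinguished ones) and two new edges $(s,s')$, $(t',t)$ of length $3D$. The distortion of an injective map $f$ between metric spaces is $\|f\|_{\mathrm{Lip}}\|f^{-1}\|_{\mathrm{Lip}}$, where $f^{-1}$ is defined on the image of $f$, and $c_p(X)$ is the infimum of the distortions of injective maps from $X$ into spaces $L_p(\Omega,\mu)$. Finally $\mu_2(G)$ is the second smallest eigenvalue, with multiplicity, of the Laplacian (degree matrix minus adjacency matrix) of $G$. **Theorem.** There are a function $C:(1,\infty)\to(0,\infty)$ and absolute constants $a,b>0$, and for every $d\in\mathbb N$ and $\mu_0>0$ there is a constant $c=c(d,\mu_0)>0$, such that the following holds. Let $G$ be a finite $d$-regular, $m$-vertex, vertex-transitive graph with $\mu_2(G)\ge\mu_0$ (in particular $m\ge 2$), let $p>1$, $q=\max\{p,2\}$, $k\ge 0$, and $N=|V(\widetilde G^{\oslash k})|$. Then $$c_p(\widetilde G^{\oslash k})\ \ge\ c\,C(p)\,k^{1/q}\log m ,$$ and, if $k\ge 1$, $$a\,C(p)(\log m)^{1-1/q}(\log N)^{1/q}\ \le\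 C(p)\,k^{1/q}\log m\ \le\ b\,C(p)(\log m)^{1-1/q}(\log N)^{1/q}.$$ -/

import Mathlib

open scoped NNReal ENNReal

universe u w

/-- A metric `s`-`t` graph: a graph with nonnegative edge lengths and two distinguished vertices.
Every (undirected) edge `e` is listed once, joins `src e` and `tgt e`, and carries an auxiliary
orientation from `src e` to `tgt e`, which is used only to substitute graphs for edges. -/
structure STGraph where
  V : Type u
  E : Type u
  src : E → V
  tgt : E → V
  len : E → ℝ≥0
  s : V
  t : V

namespace STGraph

/-- The edge `e` joins `x` and `y`, in either direction. -/
def Joins (G : STGraph.{u}) (e : G.E) (x y : G.V) : Prop :=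
  (G.src e = x ∧ G.tgt e = y) ∨ (G.src e = y ∧ G.tgt e = x)

/-- `G.HasWalk x y r`: there is a walk (ignoring orientations) of total length `r` from `x`
to `y`. -/
inductive HasWalk (G : STGraph.{u}) : G.V → G.V → ℝ≥0 → Prop
  | nil (x : G.V) : HasWalk G x x 0
  | cons {x y z : G.V} {r : ℝ≥0} (e : G.E) (h : G.Joins e x y) (hw : HasWalk G y z r) :
      HasWalk G x z (G.len e + r)

/-- The shortest-path (semi-)metric `d_len`, with value `∞` between different components. -/
noncomputable def pathDist (G : STGraph.{u}) (x y : G.V) : ℝ≥0∞ :=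
  ⨅ (r : ℝ≥0) (_ : G.HasWalk x y r), (r : ℝ≥0∞)

theorem Joins.symm {G : STGraph.{u}} {e : G.E} {x y : G.V} (h : G.Joins e x y) :
    G.Joins e y x := Or.symm h

theorem HasWalk.append {G : STGraph.{u}} {x y z : G.V} {a b : ℝ≥0}
    (h₁ : G.HasWalk x y a) (h₂ : G.HasWalk y z b) : G.HasWalk x z (a + b) := by
  induction h₁ with
  | nil x => simpa using h₂
  | cons e h _ ih => rw [add_assoc]; exact HasWalk.cons e h (ih h₂)

theorem HasWalk.reverse {G : STGraph.{u}} {x y : G.V} {a : ℝ≥0}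
    (h : G.HasWalk x y a) : G.HasWalk y x a := by
  induction h with
  | nil x => exact HasWalk.nil x
  | cons e h _ ih =>
    have h2 := ih.append (HasWalk.cons e h.symm (HasWalk.nil _))
    rwa [add_zero, add_comm] at h2

theorem pathDist_le {G : STGraph.{u}} {x y : G.V} {a : ℝ≥0} (h : G.HasWalk x y a) :
    G.pathDist x y ≤ a := iInf₂_le a h

/-- The vertex set of a metric graph, as a (semi-)metric space under its path metric. -/
noncomputable instance (G : STGraph.{u}) : PseudoEMetricSpace G.V where
  edist := G.pathDist
  edist_self x := le_antisymm (by simpa using pathDist_le (HasWalk.nil x)) bot_le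
  edist_comm x y := le_antisymm
    (le_iInf₂ fun _ h => pathDist_le h.reverse) (le_iInf₂ fun _ h => pathDist_le h.reverse)
  edist_triangle x y z := by
    conv_rhs => simp only [pathDist, ENNReal.iInf_add, ENNReal.add_iInf]
    refine le_iInf fun b => le_iInf fun hb => le_iInf fun a => le_iInf fun ha => ?_
    exact (pathDist_le (ha.append hb)).trans_eq (ENNReal.coe_add _ _)

/-- The length `d_len(s, t)` of an `s`-`t` graph. -/
noncomputable def length (G : STGraph.{u}) : ℝ≥0 := (G.pathDist G.s G.t).toNNReal

/-- A single edge of unit length, from `s` to `t`. -/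
def singleEdge : STGraph.{u} where
  V := ULift.{u} Bool
  E := PUnit
  src _ := ⟨false⟩
  tgt _ := ⟨true⟩
  len _ := 1
  s := ⟨false⟩
  t := ⟨true⟩

/-- The vertices of `H ⊘ G`: those of `H`, and for every edge of `H` the internal vertices of a
copy of `G`. -/
abbrev CompV (H G : STGraph.{u}) : Type u :=
  H.V ⊕ (H.E × {v : G.V // v ≠ G.s ∧ v ≠ G.t})

open Classical in
/-- The vertex `v` of `G`, in the copy of `G` that replaces the edge `e` of `H`: the vertices
`s` and `t` of the copy are identified with the endpoints of `e`. -/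
noncomputable def copyVertex (H G : STGraph.{u}) (e : H.E) (v : G.V) : CompV H G :=
  if hs : v = G.s then Sum.inl (H.src e)
  else if ht : v = G.t then Sum.inl (H.tgt e)
  else Sum.inr (e, ⟨v, hs, ht⟩)

/-- The composition `H ⊘ G`: every edge `e` of `H` is replaced by a copy of `G`, with lengths
scaled so that the copy has length `len e`. -/
noncomputable def comp (H G : STGraph.{u}) : STGraph.{u} where
  V := CompV H G
  E := H.E × G.E
  src e := copyVertex H G e.1 (G.src e.2)
  tgt e := copyVertex H G e.1 (G.tgt e.2)
  len e := H.len e.1 / G.length * G.len e.2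
  s := Sum.inl H.s
  t := Sum.inl H.t

/-- The recursive composition `G^{⊘k}`. -/
noncomputable def power (G : STGraph.{u}) : ℕ → STGraph.{u}
  | 0 => singleEdge
  | k + 1 => comp (power G k) G

/-- Attach to `G` two new vertices `s`, `t` by two new edges of length `r`, from `s` to the
old `s` and from the old `t` to `t`. (In `ULift Bool`, `false` is at the `s` end.) -/
def withTails (G : STGraph.{u}) (r : ℝ≥0) : STGraph.{u} where
  V := G.V ⊕ ULift.{u} Bool
  E := G.E ⊕ ULift.{u} Bool
  src
    | Sum.inl e => Sum.inl (G.src e)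
    | Sum.inr ⟨false⟩ => Sum.inr ⟨false⟩
    | Sum.inr ⟨true⟩ => Sum.inl G.t
  tgt
    | Sum.inl e => Sum.inl (G.tgt e)
    | Sum.inr ⟨false⟩ => Sum.inl G.s
    | Sum.inr ⟨true⟩ => Sum.inr ⟨true⟩
  len
    | Sum.inl e => G.len e
    | Sum.inr _ => r
  s := Sum.inr ⟨false⟩
  t := Sum.inr ⟨true⟩

end STGraph

namespace SimpleGraph

variable {V : Type u}

/-- The vertices of the stretched graph: `s`, `t`, and `D + 1` layers of copies of `V`. -/
inductive StretchedVertex (V : Type u) (D : ℕ) : Type u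
  | s : StretchedVertex V D
  | t : StretchedVertex V D
  | layer (i : Fin (D + 1)) (v : V) : StretchedVertex V D

/-- The edges of the stretched graph: those at `s`, those at `t`, the edges of `G` inside each
layer, and between consecutive layers `i`, `i + 1` an edge from `v` to `v` for each vertex `v` and
an edge from `u` to `v` for each ordered pair `(u, v)` of adjacent vertices. -/
inductive StretchedEdge (G : SimpleGraph V) (D : ℕ) : Type u
  | start (v : V) : StretchedEdge G D
  | finish (v : V) : StretchedEdge G D
  | vertical (j : Fin (D + 1)) (e : G.edgeSet) : StretchedEdge G D
  | straight (i : Fin D) (v : V) : StretchedEdge G D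
  | cross (i : Fin D) (a : G.Dart) : StretchedEdge G D

/-- The stretched graph with `D = diam G`. The edges at `s` and `t` have length `D`, all
others have length `1`. Vertical edges get an arbitrary orientation. -/
noncomputable def stretched (G : SimpleGraph V) : STGraph.{u} where
  V := StretchedVertex V G.diam
  E := StretchedEdge G G.diam
  src
    | .start _ => .s
    | .finish v => .layer (Fin.last G.diam) v
    | .vertical j e => .layer j (Quot.out e.1).1
    | .straight i v => .layer i.castSucc v
    | .cross i a => .layer i.castSucc a.fst
  tgt
    | .start v => .layer 0 v
    | .finish _ => .t
    | .vertical j e => .layer j (Quot.out e.1).2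
    | .straight i v => .layer i.succ v
    | .cross i a => .layer i.succ a.snd
  len
    | .start _ => (G.diam : ℝ≥0)
    | .finish _ => (G.diam : ℝ≥0)
    | .vertical _ _ => 1
    | .straight _ _ => 1
    | .cross _ _ => 1
  s := .s
  t := .t

/-- The doubling version `G̃` of the stretched graph: two tails of length `3 diam G` are
attached to it. -/
noncomputable def tilde (G : SimpleGraph V) : STGraph.{u} :=
  G.stretched.withTails (3 * (G.diam : ℝ≥0))

/-- The automorphism group of `G` acts transitively on the vertices. -/
def VertexTransitive (G : SimpleGraph V) : Prop :=
  ∀ x y : V, ∃ π : G ≃g G, π x = y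

/-- The second smallest eigenvalue `μ₂` of the Laplacian `D - A`, counted with multiplicity
(`eigenvalues₀` lists the eigenvalues in decreasing order). The value for graphs with fewer than
two vertices is set to `0`. -/
noncomputable def mu₂ [Fintype V] [DecidableEq V] (G : SimpleGraph V) [DecidableRel G.Adj] : ℝ :=
  if h : 2 ≤ Fintype.card V then
    (G.posSemidef_lapMatrix ℝ).isHermitian.eigenvalues₀ ⟨Fintype.card V - 2, by omega⟩
  else 0

end SimpleGraph

/-- The Lipschitz constant `sup_{x ≠ y} d(f x, f y) / d(x, y)`. -/
noncomputable def lipConst {X : Type*} {Y : Type*} [EDist X] [EDist Y] (f : X → Y) : ℝ≥0∞ :=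
  ⨆ (x : X) (y : X) (_ : x ≠ y), edist (f x) (f y) / edist x y

/-- For injective `f`, the Lipschitz constant of `f⁻¹ : f(X) → X`. -/
noncomputable def invLipConst {X : Type*} {Y : Type*} [EDist X] [EDist Y] (f : X → Y) : ℝ≥0∞ :=
  ⨆ (x : X) (y : X) (_ : x ≠ y), edist x y / edist (f x) (f y)

/-- The distortion `‖f‖_Lip * ‖f⁻¹‖_Lip` of an injective map. -/
noncomputable def distortion {X : Type*} {Y : Type*} [EDist X] [EDist Y] (f : X → Y) : ℝ≥0∞ :=
  lipConst f * invLipConst f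

/-- `c_p(X)`: the least distortion of an embedding of `X` into some space `L_p(Ω, μ)`. -/
noncomputable def lpDistortion (p : ℝ) (X : Type u) [PseudoEMetricSpace X] : ℝ≥0∞ :=
  ⨅ (Ω : Type w) (_ : MeasurableSpace Ω) (μ : MeasureTheory.Measure Ω)
    (f : X → MeasureTheory.Lp ℝ (ENNReal.ofReal p) μ) (_ : Function.Injective f), distortion f

/-! Write q = max p 2. The energy of a map is a weighted mean, over the edges, of the q-th power of
its stretch, and it is at most the q-th power of the Lipschitz constant. Each further composition
with `tilde` raises this energy by a definite amount when the inverse of the map is M-Lipschitz.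

The gain comes from uniform convexity of L_p with exponent q (`norm_midpoint_rpow_le`). A dart (u,
v) of G gives two edges from u in layer i, to u and to v in layer i + 1. Compared with their
midpoint, these two edges carry an excess proportional to ‖f(u) - f(v)‖^q in layer i + 1. Averaging
over darts replaces the layers by their centroids and keeps the mean excess
(`norm_average_sub_rpow_add_le`).

The excess is large because every layer is a copy of an expander. The spectral gap gives a Poincaré
inequality with exponent p, first for scalar functions (`sum_abs_sub_rpow_le`) and then, by
integration, for L_p-valued maps. The mean distance in a d-regular graph is at least of order log m
/ log (d + 1). So the mean of ‖f(u) - f(v)‖^q over darts is at least a constant times (log m / (p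
M))^q (`rpow_le_average_dart`). Jensen's inequality along the path from s to t through the centroids
turns this into `gains_tilde`.

After k compositions (`exists_energy_power_ge`), k times the gain is at most Lip^q, and taking q-th
roots bounds Lip · M from below by a multiple of k^(1/q) log m. The metric enters only through
potentials, that is, 1-Lipschitz functions: they extend from H to H ⊘ G and from a single copy of G
to H ⊘ G, which is how the expansion hypothesis is passed on.

For the comparison with N it is enough that m^k ≤ N ≤ m^(7k) when k ≥ 1. -/

namespace STGraph

/-! ### Potentials, and the growth of energy under composition -/

/-- A function on the vertices that is `1`-Lipschitz along every edge. -/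
def IsPotential (G : STGraph.{u}) (φ : G.V → ℝ) : Prop :=
  ∀ e, |φ (G.src e) - φ (G.tgt e)| ≤ G.len e

theorem IsPotential.le_of_hasWalk {G : STGraph.{u}} {φ : G.V → ℝ} (hφ : G.IsPotential φ)
    {x y : G.V} {r : ℝ≥0} (h : G.HasWalk x y r) : φ y - φ x ≤ r := by
  induction h with
  | nil x => simp
  | cons e h _ ih =>
    have he := abs_le.1 (hφ e)
    push_cast
    rcases h with ⟨rfl, rfl⟩ | ⟨rfl, rfl⟩ <;> linarith [he.1, he.2]

theorem IsPotential.ofReal_le_pathDist {G : STGraph.{u}} {φ : G.V → ℝ} (hφ : G.IsPotential φ)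
    (x y : G.V) : ENNReal.ofReal (φ y - φ x) ≤ G.pathDist x y := by
  refine le_iInf₂ fun r hr => ?_
  rw [← ENNReal.ofReal_coe_nnreal]
  exact ENNReal.ofReal_le_ofReal (hφ.le_of_hasWalk hr)

theorem hasWalk_edge (G : STGraph.{u}) (e : G.E) : G.HasWalk (G.src e) (G.tgt e) (G.len e) := by
  simpa using HasWalk.cons e (Or.inl ⟨rfl, rfl⟩) (HasWalk.nil (G.tgt e))

/-- A height function of `G`, growing from `0` at `s` to `1` at `t`, along shortest paths. -/
structure IsHeight (G : STGraph.{u}) (ψ : G.V → ℝ) : Prop where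
  s_eq : ψ G.s = 0
  t_eq : ψ G.t = 1
  le_len : ∀ e, |ψ (G.src e) - ψ (G.tgt e)| * G.length ≤ G.len e

theorem IsHeight.t_ne_s {G : STGraph.{u}} {ψ : G.V → ℝ} (hψ : G.IsHeight ψ) : G.t ≠ G.s := by
  intro h
  have h1 := hψ.t_eq
  rw [h, hψ.s_eq] at h1
  exact zero_ne_one h1

theorem copyVertex_s (H G : STGraph.{u}) (e : H.E) :
    copyVertex H G e G.s = Sum.inl (H.src e) := by
  simp [copyVertex]

theorem copyVertex_t (H G : STGraph.{u}) (h : G.t ≠ G.s) (e : H.E) :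
    copyVertex H G e G.t = Sum.inl (H.tgt e) := by
  simp [copyVertex, h]

/-- Interpolate between the endpoint values on each copy of G by means of the height ψ. This shows
that distances in H do not shrink in H ⊘ G. -/
theorem IsPotential.exists_extension {H G : STGraph.{u}} {φ : H.V → ℝ} (hφ : H.IsPotential φ)
    {ψ : G.V → ℝ} (hψ : G.IsHeight ψ) (hL : 0 < G.length) :
    ∃ φ' : (comp H G).V → ℝ, (comp H G).IsPotential φ' ∧ ∀ x, φ' (Sum.inl x) = φ x := by
  let φ' : CompV H G → ℝ := Sum.elim φ
    fun z => φ (H.src z.1) + (φ (H.tgt z.1) - φ (H.src z.1)) * ψ z.2.1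
  have key (e : H.E) (v : G.V) : φ' (copyVertex H G e v) =
      φ (H.src e) + (φ (H.tgt e) - φ (H.src e)) * ψ v := by
    by_cases hs : v = G.s
    · subst hs
      simp [copyVertex_s, φ', hψ.s_eq]
    by_cases ht : v = G.t
    · subst ht
      simp [copyVertex_t H G hψ.t_ne_s, φ', hψ.t_eq]
    · simp [copyVertex, hs, ht, φ']
  refine ⟨φ', fun e => ?_, fun x => rfl⟩
  have hL' : (0 : ℝ) < G.length := hL
  change |φ' (copyVertex H G e.1 (G.src e.2)) - φ' (copyVertex H G e.1 (G.tgt e.2))| ≤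
    ((H.len e.1 / G.length * G.len e.2 : ℝ≥0) : ℝ)
  rw [key, key, add_sub_add_left_eq_sub, ← mul_sub, abs_mul, abs_sub_comm]
  push_cast
  calc |φ (H.src e.1) - φ (H.tgt e.1)| * |ψ (G.src e.2) - ψ (G.tgt e.2)|
      ≤ H.len e.1 * (G.len e.2 / G.length) := by
        gcongr
        · exact hφ e.1
        · rw [le_div_iff₀ hL']
          exact hψ.le_len e.2
    _ = _ := by ring

/-- Equal values at the two terminals allow the scaled potential to be continued by a constant
outside the copy at `e₀`. This is why `Gains` tests only potentials with χ(s) = χ(t). -/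
theorem IsPotential.exists_local {H G : STGraph.{u}} {χ : G.V → ℝ} (hχ : G.IsPotential χ)
    (hst : χ G.s = χ G.t) (hts : G.t ≠ G.s) (e₀ : H.E) :
    ∃ φ : (comp H G).V → ℝ, (comp H G).IsPotential φ ∧
      ∀ v, φ (copyVertex H G e₀ v) = H.len e₀ / G.length * χ v := by
  classical
  let r : ℝ := H.len e₀ / G.length
  let φ : CompV H G → ℝ := Sum.elim (fun _ => r * χ G.s)
    fun z => if z.1 = e₀ then r * χ z.2.1 else r * χ G.s
  have key (e : H.E) (v : G.V) : φ (copyVertex H G e v) =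
      if e = e₀ then r * χ v else r * χ G.s := by
    by_cases hs : v = G.s
    · subst hs
      simp [copyVertex_s, φ]
    by_cases ht : v = G.t
    · subst ht
      simp [copyVertex_t H G hts, φ, hst]
    · simp [copyVertex, hs, ht, φ]
  refine ⟨φ, fun e => ?_, fun v => by simp [key, r]⟩
  change |φ (copyVertex H G e.1 (G.src e.2)) - φ (copyVertex H G e.1 (G.tgt e.2))| ≤
    ((H.len e.1 / G.length * G.len e.2 : ℝ≥0) : ℝ)
  rw [key, key]
  split_ifs with h
  · rw [← mul_sub, abs_mul, h]
    push_cast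
    have hr : |r| = (H.len e₀ : ℝ) / G.length := abs_of_nonneg (by positivity)
    rw [hr]
    exact mul_le_mul_of_nonneg_left (hχ e.2) (by positivity)
  · rw [sub_self, abs_zero]
    positivity

section

variable {E : Type*} [NormedAddCommGroup E]

/-- The inverse of `f` is `M`-Lipschitz, in terms of potentials. -/
def Expands (G : STGraph.{u}) (M : ℝ) (f : G.V → E) : Prop :=
  ∀ φ, G.IsPotential φ → ∀ x y, φ y - φ x ≤ M * ‖f x - f y‖

theorem Expands.inl {H G : STGraph.{u}} {M : ℝ} {f : (comp H G).V → E}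
    (hf : (comp H G).Expands M f) {ψ : G.V → ℝ} (hψ : G.IsHeight ψ) (hL : 0 < G.length) :
    H.Expands M fun x => f (Sum.inl x) := by
  intro φ hφ x y
  obtain ⟨φ', hφ', h⟩ := hφ.exists_extension hψ hL
  simpa [h] using hf φ' hφ' (Sum.inl x) (Sum.inl y)

/-- The weighted average of the `q`-th powers of the stretch of `f` along edges. -/
noncomputable def energy (G : STGraph.{u}) [Fintype G.E] (W : G.E → ℝ) (q : ℝ) (f : G.V → E) : ℝ :=
  ∑ e, W e * (‖f (G.src e) - f (G.tgt e)‖ / G.len e) ^ q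

theorem energy_le {G : STGraph.{u}} [Fintype G.E] {W : G.E → ℝ} (hW : ∀ e, 0 ≤ W e)
    (hW1 : ∑ e, W e = 1) {q : ℝ} (hq : 0 ≤ q) {f : G.V → E} {L : ℝ} (hL : 0 ≤ L)
    (hf : ∀ e, ‖f (G.src e) - f (G.tgt e)‖ ≤ L * G.len e) : G.energy W q f ≤ L ^ q := by
  calc G.energy W q f ≤ ∑ e, W e * L ^ q := by
        refine Finset.sum_le_sum fun e _ => mul_le_mul_of_nonneg_left ?_ (hW e)
        exact Real.rpow_le_rpow (by positivity)
          (div_le_of_le_mul₀ (by positivity) hL (hf e)) hq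
    _ = L ^ q := by rw [← Finset.sum_mul, hW1, one_mul]

variable [NormedSpace ℝ E]

/-- In `G`, the stretch of the pair `s`, `t` is less than the average stretch of the edges,
by the amount `γ`, for any map whose inverse is `M`-Lipschitz. -/
def Gains (G : STGraph.{u}) [Fintype G.E] (E : Type*) [NormedAddCommGroup E]
    (W : G.E → ℝ) (q M γ : ℝ) : Prop :=
  ∀ g : G.V → E, (∀ χ, G.IsPotential χ → χ G.s = χ G.t → ∀ x y, χ y - χ x ≤ M * ‖g x - g y‖) →
    (‖g G.s - g G.t‖ / G.length) ^ q + γ ≤ G.energy W q g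

noncomputable instance (H G : STGraph.{u}) [Fintype H.E] [Fintype G.E] : Fintype (comp H G).E :=
  inferInstanceAs (Fintype (H.E × G.E))

/-- Apply the gain of G to each copy separately. The pair s, t of the copy at e is the edge e of H,
so the weighted sum of the left-hand sides is the energy of the restriction to H. -/
theorem Gains.energy_comp {H G : STGraph.{u}} [Fintype H.E] [Fintype G.E]
    {U : H.E → ℝ} (hU : ∀ e, 0 ≤ U e) (hU1 : ∑ e, U e = 1) {W : G.E → ℝ} {q M γ : ℝ}
    (hG : G.Gains E W q M γ) (hts : G.t ≠ G.s) (hL : 0 < G.length) (hlen : ∀ e, 0 < H.len e)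
    {f : (comp H G).V → E} (hf : (comp H G).Expands M f) :
    H.energy U q (fun x => f (Sum.inl x)) + γ ≤
      (comp H G).energy (fun e => U e.1 * W e.2) q f := by
  have hL' : (0 : ℝ) < G.length := hL
  have step (e : H.E) : (‖f (Sum.inl (H.src e)) - f (Sum.inl (H.tgt e))‖ / H.len e) ^ q + γ ≤
      ∑ e', W e' * (‖f (copyVertex H G e (G.src e')) - f (copyVertex H G e (G.tgt e'))‖ /
        (H.len e / G.length * G.len e')) ^ q := by
    have he : (0 : ℝ) < H.len e := hlen e
    have hr : (0 : ℝ) < H.len e / G.length := by positivity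
    set r : ℝ := H.len e / G.length with hrdef
    have norm_eq (x y : G.V) : ‖r⁻¹ • f (copyVertex H G e x) - r⁻¹ • f (copyVertex H G e y)‖ =
        ‖f (copyVertex H G e x) - f (copyVertex H G e y)‖ / r := by
      rw [← smul_sub, norm_smul, Real.norm_of_nonneg (by positivity)]
      field_simp
    -- Dividing by r turns the copy back into G at its own scale, so M stays the same for every
    -- copy.
    have h := hG (fun v => r⁻¹ • f (copyVertex H G e v)) ?_
    · have hrL : r * G.length = H.len e := div_mul_cancel₀ _ hL'.ne'
      simp only [energy, norm_eq, div_div, hrL] at h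
      rw [copyVertex_s, copyVertex_t H G hts] at h
      exact h
    · intro χ hχ hst x y
      obtain ⟨φ, hφ, h⟩ := hχ.exists_local hst hts e
      have h2 := hf φ hφ (copyVertex H G e x) (copyVertex H G e y)
      rw [h, h, ← mul_sub] at h2
      rw [norm_eq, ← mul_div_assoc, le_div_iff₀ hr, mul_comm]
      exact h2
  have hsum : (comp H G).energy (fun e => U e.1 * W e.2) q f = ∑ e, U e *
      ∑ e', W e' * (‖f (copyVertex H G e (G.src e')) - f (copyVertex H G e (G.tgt e'))‖ /
        (H.len e / G.length * G.len e')) ^ q := by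
    refine Eq.trans ?_ ((Fintype.sum_prod_type' (f := fun e e' => U e * (W e' *
      (‖f (copyVertex H G e (G.src e')) - f (copyVertex H G e (G.tgt e'))‖ /
        (H.len e / G.length * G.len e')) ^ q))).trans ?_)
    · refine Finset.sum_congr rfl fun e _ => ?_
      rw [← mul_assoc]
      simp [comp]
    · simp only [Finset.mul_sum]
  rw [hsum]
  calc H.energy U q (fun x => f (Sum.inl x)) + γ
      = ∑ e, U e * ((‖f (Sum.inl (H.src e)) - f (Sum.inl (H.tgt e))‖ / H.len e) ^ q + γ) := by
        simp only [mul_add, Finset.sum_add_distrib, ← Finset.sum_mul, hU1, one_mul, energy]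
    _ ≤ _ := Finset.sum_le_sum fun e _ => mul_le_mul_of_nonneg_left (step e) (hU e)

/-- The weights U are products of the weights W; they do not depend on M, γ or f. -/
theorem exists_energy_power_ge {G : STGraph.{u}} [Fintype G.E] {W : G.E → ℝ} {q : ℝ}
    (hW : ∀ e, 0 ≤ W e) (hW1 : ∑ e, W e = 1) {ψ : G.V → ℝ} (hψ : G.IsHeight ψ)
    (hL : 0 < G.length) (hlen : ∀ e, 0 < G.len e) (k : ℕ) :
    (∀ e, 0 < (G.power k).len e) ∧
    ∃ (_ : Fintype (G.power k).E) (U : (G.power k).E → ℝ), (∀ e, 0 ≤ U e) ∧ ∑ e, U e = 1 ∧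
      ∀ M γ, G.Gains E W q M γ → ∀ f : (G.power k).V → E, (G.power k).Expands M f →
        k * γ ≤ (G.power k).energy U q f := by
  induction k with
  | zero =>
    refine ⟨fun e => one_pos, inferInstanceAs (Fintype PUnit), fun _ => 1, fun _ => zero_le_one,
      ?_, fun M γ _ f _ => ?_⟩
    · exact Fintype.sum_unique (ι := PUnit) _
    · rw [Nat.cast_zero, zero_mul]
      exact Finset.sum_nonneg fun e _ => by positivity
  | succ k ih =>
    obtain ⟨hlen', _, U, hU, hU1, ih⟩ := ih
    refine ⟨fun e => mul_pos (div_pos (hlen' e.1) hL) (hlen e.2),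
      (inferInstance : Fintype (comp (G.power k) G).E), fun e => U e.1 * W e.2,
      fun e => mul_nonneg (hU _) (hW _), ?_, fun M γ hG f hf => ?_⟩
    · have h := Fintype.sum_prod_type' (f := fun e e' => U e * W e')
      refine h.trans ?_
      simp only [← Finset.mul_sum, hW1, mul_one, hU1]
    · have h1 := hG.energy_comp hU hU1 hψ.t_ne_s hL hlen' hf
      have h2 := ih M γ hG _ (Expands.inl hf hψ hL)
      push_cast
      calc ((k : ℝ) + 1) * γ = k * γ + γ := by ring
        _ ≤ _ := by linarith
        _ ≤ _ := h1

end

end STGraph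

/-! ### Sums over darts and the spectral gap -/

namespace SimpleGraph

variable {V : Type u} [Fintype V] (G : SimpleGraph V) [DecidableRel G.Adj]

theorem sum_darts_eq {M : Type*} [AddCommMonoid M] (F : V → V → M) :
    ∑ a : G.Dart, F a.fst a.snd = ∑ u, ∑ v, if G.Adj u v then F u v else 0 := by
  rw [← Fintype.sum_prod_type' (f := fun u v => if G.Adj u v then F u v else 0),
    ← Finset.sum_filter]
  refine Finset.sum_bij (fun a _ => a.toProd) (fun a _ => by simp [a.adj])
    (fun a _ b _ h => Dart.ext _ _ h) (fun b hb => ?_) (fun a _ => rfl)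
  exact ⟨⟨b, (Finset.mem_filter.1 hb).2⟩, Finset.mem_univ _, rfl⟩

theorem sum_darts_fst {M : Type*} [AddCommMonoid M] {d : ℕ} (hd : G.IsRegularOfDegree d)
    (F : V → M) : ∑ a : G.Dart, F a.fst = d • ∑ v, F v := by
  rw [G.sum_darts_eq fun u _ => F u, Finset.smul_sum]
  refine Finset.sum_congr rfl fun u _ => ?_
  rw [← Finset.sum_filter, Finset.sum_const]
  congr 1
  rw [← hd u, ← card_neighborFinset_eq_degree]
  congr 1
  ext v
  simp

theorem sum_darts_snd {M : Type*} [AddCommMonoid M] {d : ℕ} (hd : G.IsRegularOfDegree d)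
    (F : V → M) : ∑ a : G.Dart, F a.snd = d • ∑ v, F v := by
  rw [← G.sum_darts_fst hd, G.sum_darts_eq fun _ v => F v, G.sum_darts_eq fun u _ => F u,
    Finset.sum_comm]
  simp only [G.adj_comm]

theorem card_dart_of_regular {d : ℕ} (hd : G.IsRegularOfDegree d) :
    Fintype.card G.Dart = d * Fintype.card V := by
  have h := G.sum_darts_fst hd fun _ => 1
  simpa only [Finset.sum_const, Finset.card_univ, smul_eq_mul, mul_one] using h

open Matrix in
-- Expand in an eigenbasis of the Laplacian. The constant vector is orthogonal to every eigenvector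
-- with positive eigenvalue, hence spans the line of the last one, and g has no component there. The
-- factor 1/2 compensates for the two darts of each edge.
theorem mu₂_mul_sum_sq_le [DecidableEq V] (hpos : 0 < G.mu₂) {g : V → ℝ} (hg : ∑ v, g v = 0) :
    G.mu₂ * ∑ v, g v ^ 2 ≤ (∑ a : G.Dart, (g a.fst - g a.snd) ^ 2) / 2 := by
  have hcard : 2 ≤ Fintype.card V := by
    by_contra h
    simp [mu₂, h] at hpos
  set hA := (G.posSemidef_lapMatrix ℝ).isHermitian
  set m := Fintype.card V with hm
  set eqv := Fintype.equivOfCardEq (Fintype.card_fin m) with heqv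
  have hev (i : Fin m) : hA.eigenvalues (eqv i) = hA.eigenvalues₀ i := by
    simp [IsHermitian.eigenvalues, eqv]
  have hmu : G.mu₂ = hA.eigenvalues₀ ⟨m - 2, by omega⟩ := by
    rw [mu₂, dif_pos hcard]
  -- The eigenvalues are listed in decreasing order, so index m - 1 is the bottom one and all others
  -- are at least the entry m - 2.
  let last : V := eqv ⟨m - 1, by omega⟩
  have hge (i : V) (hi : i ≠ last) : G.mu₂ ≤ hA.eigenvalues i := by
    obtain ⟨j, rfl⟩ := eqv.surjective i
    rw [hev, hmu]
    refine hA.eigenvalues₀_antitone ?_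
    have : j.1 ≠ m - 1 := fun h => hi (congrArg eqv (Fin.ext h))
    have := j.2
    exact Fin.mk_le_mk.2 (by omega)
  let b := hA.eigenvectorBasis
  let T := toEuclideanLin (G.lapMatrix ℝ)
  have hT (i : V) : T (b i) = hA.eigenvalues i • b i := by
    apply (WithLp.equiv 2 _).injective
    exact hA.mulVec_eigenvectorBasis i
  have hsymm : T.IsSymmetric := isSymmetric_toEuclideanLin_iff.2 hA
  let one : EuclideanSpace ℝ V := WithLp.toLp 2 fun _ => 1
  have hT1 : T one = 0 := by
    apply (WithLp.equiv 2 _).injective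
    exact G.lapMatrix_mulVec_const_eq_zero (R := ℝ)
  have horth (i : V) (hi : i ≠ last) : inner ℝ (b i) one = (0 : ℝ) := by
    have h : inner ℝ (T (b i)) one = inner ℝ (b i) (T one) := hsymm _ _
    rw [hT, hT1, inner_zero_right, inner_smul_left] at h
    exact (mul_eq_zero.1 h).resolve_left (ne_of_gt (hpos.trans_le (hge i hi)))
  have hone : one = inner ℝ (b last) one • b last := by
    conv_lhs => rw [← b.sum_repr' one]
    rw [Finset.sum_eq_single last (fun i _ hi => by rw [horth i hi, zero_smul]) (by simp)]
  have : Nonempty V := ⟨last⟩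
  have hone0 : one ≠ 0 := fun h => by
    have h2 := congrArg (fun x : EuclideanSpace ℝ V => x last) h
    simp [one] at h2
  have hc : (inner ℝ (b last) one : ℝ) ≠ 0 := fun h => hone0 (by rw [hone, h, zero_smul])
  let x : EuclideanSpace ℝ V := WithLp.toLp 2 g
  have hx1 : inner ℝ one x = (0 : ℝ) := by
    simp [one, x, PiLp.inner_apply, hg]
  have hxlast : inner ℝ (b last) x = (0 : ℝ) := by
    rw [hone, inner_smul_left] at hx1
    exact (mul_eq_zero.1 hx1).resolve_left hc
  have hnorm : ∑ v, g v ^ 2 = ∑ i, inner ℝ (b i) x ^ 2 := by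
    have h := b.sum_sq_norm_inner_right x
    rw [EuclideanSpace.norm_sq_eq] at h
    simpa [x] using h.symm
  have hquad : (inner ℝ x (T x) : ℝ) = ∑ i, hA.eigenvalues i * inner ℝ (b i) x ^ 2 := by
    rw [← b.sum_inner_mul_inner x (T x)]
    refine Finset.sum_congr rfl fun i _ => ?_
    rw [← hsymm (b i) x, hT, inner_smul_left, real_inner_comm]
    simp
    ring
  have hlap : (inner ℝ x (T x) : ℝ) = (∑ a : G.Dart, (g a.fst - g a.snd) ^ 2) / 2 := by
    rw [G.sum_darts_eq fun u v => (g u - g v) ^ 2, ← G.lapMatrix_toLinearMap₂' ℝ g,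
      toLinearMap₂'_apply']
    rw [real_inner_comm]
    simp [x, T, PiLp.inner_apply, toEuclideanLin, dotProduct, mulVec]
  rw [← hlap, hquad, hnorm, Finset.mul_sum]
  refine Finset.sum_le_sum fun i _ => ?_
  by_cases hi : i = last
  · rw [hi, hxlast]
    simp
  · exact mul_le_mul_of_nonneg_right (hge i hi) (sq_nonneg _)

end SimpleGraph

/-! ### Signed powers and elementary inequalities -/

/-- The odd extension of `x ↦ x ^ θ` to the real line. -/
noncomputable def signedPow (θ x : ℝ) : ℝ := max x 0 ^ θ - max (-x) 0 ^ θ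

section signedPow

variable {θ : ℝ}

theorem signedPow_of_nonneg (hθ : 0 < θ) {x : ℝ} (hx : 0 ≤ x) : signedPow θ x = x ^ θ := by
  rw [signedPow, max_eq_left hx, max_eq_right (by linarith), Real.zero_rpow hθ.ne', sub_zero]

theorem signedPow_neg (x : ℝ) : signedPow θ (-x) = -signedPow θ x := by
  simp [signedPow]

theorem signedPow_sq (hθ : 0 < θ) (x : ℝ) : signedPow θ x ^ 2 = |x| ^ (2 * θ) := by
  have h (y : ℝ) (hy : 0 ≤ y) : signedPow θ y ^ 2 = |y| ^ (2 * θ) := by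
    rw [signedPow_of_nonneg hθ hy, abs_of_nonneg hy, mul_comm, Real.rpow_mul hy, Real.rpow_two]
  rcases le_total 0 x with hx | hx
  · exact h x hx
  · have := h (-x) (by linarith)
    rwa [signedPow_neg, neg_sq, abs_neg] at this

theorem continuous_signedPow (hθ : 0 < θ) : Continuous (signedPow θ) := by
  unfold signedPow
  exact ((continuous_id.max continuous_const).rpow_const fun _ => Or.inr hθ.le).sub
    ((continuous_neg.max continuous_const).rpow_const fun _ => Or.inr hθ.le)

theorem signedPow_nonneg (hθ : 0 < θ) {x : ℝ} (hx : 0 ≤ x) : 0 ≤ signedPow θ x := by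
  rw [signedPow_of_nonneg hθ hx]
  positivity

theorem signedPow_nonpos (hθ : 0 < θ) {x : ℝ} (hx : x ≤ 0) : signedPow θ x ≤ 0 := by
  have := signedPow_nonneg hθ (neg_nonneg.2 hx)
  rw [signedPow_neg] at this
  linarith

/-- To bound `|signedPow θ a - signedPow θ b|` by an even symmetric function of `a`, `b`, it
suffices to consider `0 ≤ b ≤ a` and numbers of opposite signs. -/
theorem abs_signedPow_sub_le_of {B : ℝ → ℝ → ℝ} (hθ : 0 < θ) (hsymm : ∀ a b, B a b = B b a)
    (hneg : ∀ a b, B (-a) (-b) = B a b)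
    (h₁ : ∀ a b, 0 ≤ b → b ≤ a → a ^ θ - b ^ θ ≤ B a b)
    (h₂ : ∀ a b, 0 ≤ a → 0 ≤ b → a ^ θ + b ^ θ ≤ B a (-b)) (a b : ℝ) :
    |signedPow θ a - signedPow θ b| ≤ B a b := by
  have key (a b : ℝ) (hb : 0 ≤ b) (hab : b ≤ a) : |signedPow θ a - signedPow θ b| ≤ B a b := by
    rw [signedPow_of_nonneg hθ hb, signedPow_of_nonneg hθ (hb.trans hab), abs_of_nonneg]
    · exact h₁ a b hb hab
    · exact sub_nonneg.2 (Real.rpow_le_rpow hb hab hθ.le)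
  have key₂ (a b : ℝ) (ha : 0 ≤ a) (hb : b ≤ 0) : |signedPow θ a - signedPow θ b| ≤ B a b := by
    obtain ⟨c, rfl⟩ : ∃ c, b = -c := ⟨-b, by simp⟩
    have hc : 0 ≤ c := by linarith
    rw [signedPow_neg, sub_neg_eq_add, signedPow_of_nonneg hθ ha, signedPow_of_nonneg hθ hc,
      abs_of_nonneg (by positivity)]
    exact h₂ a c ha hc
  have key₃ (a b : ℝ) (ha : 0 ≤ a) (hb : 0 ≤ b) : |signedPow θ a - signedPow θ b| ≤ B a b := by
    rcases le_total b a with h | h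
    · exact key a b hb h
    · rw [abs_sub_comm, hsymm]
      exact key b a ha h
  rcases le_total 0 a with ha | ha <;> rcases le_total 0 b with hb | hb
  · exact key₃ a b ha hb
  · exact key₂ a b ha hb
  · rw [abs_sub_comm, hsymm]
    exact key₂ b a hb ha
  · have := key₃ (-a) (-b) (by linarith) (by linarith)
    rwa [hneg, signedPow_neg, signedPow_neg, neg_sub_neg, abs_sub_comm] at this

/-- For equal signs this is subadditivity of the θ-th power; opposite signs cost the factor 2. -/
theorem abs_signedPow_sub_le_of_le_one (hθ : 0 < θ) (hθ1 : θ ≤ 1) (a b : ℝ) :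
    |signedPow θ a - signedPow θ b| ≤ 2 * |a - b| ^ θ := by
  refine abs_signedPow_sub_le_of (B := fun a b => 2 * |a - b| ^ θ) hθ
    (fun a b => by rw [abs_sub_comm]) (fun a b => by rw [neg_sub_neg, abs_sub_comm])
    (fun a b hb hab => ?_) (fun a b ha hb => ?_) a b
  · have h := Real.rpow_add_le_add_rpow (sub_nonneg.2 hab) hb hθ.le hθ1
    rw [sub_add_cancel] at h
    rw [abs_of_nonneg (sub_nonneg.2 hab)]
    have : 0 ≤ (a - b) ^ θ := Real.rpow_nonneg (sub_nonneg.2 hab) _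
    linarith
  · rw [sub_neg_eq_add, abs_of_nonneg (by positivity)]
    have h₁ := Real.rpow_le_rpow ha (le_add_of_nonneg_right hb : a ≤ a + b) hθ.le
    have h₂ := Real.rpow_le_rpow hb (le_add_of_nonneg_left ha : b ≤ a + b) hθ.le
    linarith

/-- A mean value estimate; for equal signs it is Bernoulli's inequality at b / a. -/
theorem abs_signedPow_sub_le_of_one_le (hθ : 1 ≤ θ) (a b : ℝ) :
    |signedPow θ a - signedPow θ b| ≤ θ * max |a| |b| ^ (θ - 1) * |a - b| := by
  refine abs_signedPow_sub_le_of (B := fun a b => θ * max |a| |b| ^ (θ - 1) * |a - b|)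
    (by linarith) (fun a b => by rw [abs_sub_comm, max_comm])
    (fun a b => by rw [neg_sub_neg, abs_sub_comm, abs_neg, abs_neg])
    (fun a b hb hab => ?_) (fun a b ha hb => ?_) a b
  · rw [abs_of_nonneg hb, abs_of_nonneg (hb.trans hab), max_eq_left hab,
      abs_of_nonneg (sub_nonneg.2 hab)]
    rcases (hb.trans hab).eq_or_lt with rfl | ha
    · obtain rfl : b = 0 := le_antisymm hab hb
      simp
    have h := one_add_mul_self_le_rpow_one_add (s := b / a - 1) (by
      have : 0 ≤ b / a := by positivity
      linarith) hθ
    rw [add_sub_cancel, Real.div_rpow hb ha.le, le_div_iff₀ (by positivity)] at h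
    have h2 : a ^ θ = a ^ (θ - 1) * a := by
      rw [← Real.rpow_add_one ha.ne', sub_add_cancel]
    rw [h2] at h ⊢
    have h3 : (1 + θ * (b / a - 1)) * (a ^ (θ - 1) * a) =
      a ^ (θ - 1) * a - θ * a ^ (θ - 1) * (a - b) := by field_simp; ring
    linarith
  · rw [sub_neg_eq_add, abs_neg, abs_of_nonneg ha, abs_of_nonneg hb, abs_of_nonneg (by positivity)]
    have h (x : ℝ) (hx : 0 ≤ x) (hxm : x ≤ max a b) : x ^ θ ≤ max a b ^ (θ - 1) * x := by
      rcases hx.eq_or_lt with rfl | hx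
      · rw [Real.zero_rpow (by linarith), mul_zero]
      calc x ^ θ = x ^ (θ - 1) * x := by rw [← Real.rpow_add_one hx.ne', sub_add_cancel]
        _ ≤ _ := by gcongr
    have h₁ := h a ha (le_max_left _ _)
    have h₂ := h b hb (le_max_right _ _)
    have h₃ : 0 ≤ max a b ^ (θ - 1) * (a + b) := by positivity
    nlinarith

end signedPow

/-- An elementary form of Young's inequality. -/
theorem sq_mul_rpow_le {p ε x y : ℝ} (hp : 2 ≤ p) (hε : 0 < ε) (hx : 0 ≤ x) (hy : 0 ≤ y) :
    x ^ 2 * y ^ (p - 2) ≤ ε ^ 2 * y ^ p + ε ^ (2 - p) * x ^ p := by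
  have hsplit (z : ℝ) (hz : 0 ≤ z) : z ^ p = z ^ 2 * z ^ (p - 2) := by
    rcases hz.eq_or_lt with rfl | hz
    · rw [Real.zero_rpow (by linarith)]; simp
    · rw [← Real.rpow_two, ← Real.rpow_add hz, add_sub_cancel]
  rcases le_total x (ε * y) with h | h
  · calc x ^ 2 * y ^ (p - 2) ≤ (ε * y) ^ 2 * y ^ (p - 2) := by gcongr
      _ = ε ^ 2 * y ^ p := by rw [hsplit y hy]; ring
      _ ≤ _ := le_add_of_nonneg_right (by positivity)
  · calc x ^ 2 * y ^ (p - 2) ≤ x ^ 2 * (x / ε) ^ (p - 2) := by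
          refine mul_le_mul_of_nonneg_left (Real.rpow_le_rpow hy ?_ (by linarith)) (sq_nonneg x)
          rwa [le_div_iff₀ hε, mul_comm]
      _ = ε ^ (2 - p) * x ^ p := by
          rw [hsplit x hx, Real.div_rpow hx hε.le, ← neg_sub p 2, Real.rpow_neg hε.le]
          field_simp
      _ ≤ _ := le_add_of_nonneg_left (by positivity)

/-! ### Poincaré inequality with exponent p -/

namespace SimpleGraph

variable {V : Type u} [Fintype V]

/-- The indicator of a component, minus its mean, has zero Dirichlet sum, so the spectral gap forces
it to vanish. -/
theorem connected_of_mu₂_pos [DecidableEq V] (G : SimpleGraph V) [DecidableRel G.Adj]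
    (hpos : 0 < G.mu₂) : G.Connected := by
  classical
  have hcard : 2 ≤ Fintype.card V := by
    by_contra h
    simp [mu₂, h] at hpos
  have : Nonempty V := Fintype.card_pos_iff.1 (by omega)
  refine ⟨fun u v => ?_⟩
  let g₀ : V → ℝ := fun w => if G.Reachable u w then 1 else 0
  let c : ℝ := (∑ w, g₀ w) / Fintype.card V
  have hg : ∑ w, (g₀ w - c) = 0 := by
    simp only [Finset.sum_sub_distrib, Finset.sum_const, Finset.card_univ, nsmul_eq_mul, c]
    field_simp
    simp
  have h := G.mu₂_mul_sum_sq_le hpos hg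
  have h0 : ∑ a : G.Dart, (g₀ a.fst - c - (g₀ a.snd - c)) ^ 2 = 0 := by
    refine Finset.sum_eq_zero fun a _ => ?_
    have : G.Reachable u a.fst ↔ G.Reachable u a.snd :=
      ⟨fun h => h.trans a.adj.reachable, fun h => h.trans a.adj.symm.reachable⟩
    simp [g₀, this]
  rw [h0, zero_div] at h
  have hs : ∑ w, (g₀ w - c) ^ 2 = 0 :=
    le_antisymm (nonpos_of_mul_nonpos_right h hpos) (Finset.sum_nonneg fun _ _ => sq_nonneg _)
  rw [Finset.sum_eq_zero_iff_of_nonneg fun _ _ => sq_nonneg _] at hs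
  have hu : g₀ u - c = 0 := by simpa using hs u (Finset.mem_univ _)
  have hv : g₀ v - c = 0 := by simpa using hs v (Finset.mem_univ _)
  have : g₀ v = g₀ u := by linarith
  by_contra hr
  simp [g₀, hr] at this

/-- Intermediate value theorem, with c running between the minimum and the maximum of f. -/
theorem exists_sum_signedPow_eq_zero [Nonempty V] {θ : ℝ} (hθ : 0 < θ) (f : V → ℝ) :
    ∃ c, ∑ v, signedPow θ (f v - c) = 0 := by
  have hcont : Continuous fun c => ∑ v, signedPow θ (f v - c) :=
    continuous_finsetSum _ fun v _ =>
      (continuous_signedPow hθ).comp (continuous_const.sub continuous_id)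
  obtain ⟨u, hu⟩ := Finite.exists_max f
  obtain ⟨w, hw⟩ := Finite.exists_min f
  have := mem_range_of_exists_le_of_exists_ge hcont (c := 0)
    ⟨f u, Finset.sum_nonpos fun v _ => signedPow_nonpos hθ (sub_nonpos.2 (hu v))⟩
    ⟨f w, Finset.sum_nonneg fun v _ => signedPow_nonneg hθ (sub_nonneg.2 (hw v))⟩
  exact this

end SimpleGraph

theorem Real.add_rpow_le_two_rpow_mul {x y p : ℝ} (hx : 0 ≤ x) (hy : 0 ≤ y) (hp : 1 ≤ p) :
    (x + y) ^ p ≤ 2 ^ (p - 1) * (x ^ p + y ^ p) := by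
  lift x to ℝ≥0 using hx
  lift y to ℝ≥0 using hy
  exact_mod_cast NNReal.rpow_add_le_mul_rpow_add_rpow x y hp

namespace SimpleGraph

variable {V : Type u} [Fintype V] [DecidableEq V] (G : SimpleGraph V) [DecidableRel G.Adj]

/-- The bound for the `p`-th moment of a function that is balanced in the sense that the sum of
its signed powers with exponent `p / 2` vanishes. -/
theorem sum_abs_rpow_le_of_sum_signedPow_eq_zero {d : ℕ} (hd : G.IsRegularOfDegree d) {μ₀ η p : ℝ}
    (hμ₀ : 0 < μ₀) (hμ : μ₀ ≤ G.mu₂) (hη : 0 < η) (hη1 : η ≤ 1) (hηd : η * (2 * d) ≤ μ₀)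
    (hp : 1 ≤ p) {g : V → ℝ} (hg : ∑ v, signedPow (p / 2) (g v) = 0) :
    d * ∑ v, |g v| ^ p ≤ (p / η) ^ p * ∑ a : G.Dart, |g a.fst - g a.snd| ^ p := by
  have hθ : 0 < p / 2 := by linarith
  -- Matoušek-type extrapolation: the exponent 2 inequality is applied to the signed (p/2)-th powers
  -- of g, whose squares are |g|^p.
  have hgap := G.mu₂_mul_sum_sq_le (hμ₀.trans_le hμ) hg
  simp only [signedPow_sq hθ, mul_div_cancel₀ p (two_ne_zero' ℝ)] at hgap
  set F := ∑ v, |g v| ^ p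
  set D := ∑ a : G.Dart, |g a.fst - g a.snd| ^ p
  have hF : 0 ≤ F := Finset.sum_nonneg fun v _ => by positivity
  have hD : 0 ≤ D := Finset.sum_nonneg fun v _ => by positivity
  have hgap' := (mul_le_mul_of_nonneg_right hμ hF).trans hgap
  have hpη : 1 ≤ p / η := by
    rw [le_div_iff₀ hη]
    linarith
  rcases le_total p 2 with hp2 | hp2
  · have h1 : ∑ a : G.Dart, (signedPow (p / 2) (g a.fst) - signedPow (p / 2) (g a.snd)) ^ 2 ≤
        4 * D := by
      rw [Finset.mul_sum]
      refine Finset.sum_le_sum fun a _ => ?_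
      have h := abs_signedPow_sub_le_of_le_one hθ (by linarith) (g a.fst) (g a.snd)
      calc _ ≤ (2 * |g a.fst - g a.snd| ^ (p / 2)) ^ 2 :=
            sq_le_sq' (by linarith [abs_le.1 h]) (by linarith [abs_le.1 h])
        _ = 4 * (|g a.fst - g a.snd| ^ (p / 2)) ^ 2 := by ring
        _ = _ := by
          rw [← Real.rpow_two, ← Real.rpow_mul (abs_nonneg _), div_mul_cancel₀ p two_ne_zero]
    have h2 : η * (d * F) ≤ D := by nlinarith
    calc d * F ≤ 1 / η * D := by rw [one_div, ← div_eq_inv_mul, le_div_iff₀ hη]; linarith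
      _ ≤ (p / η) ^ p * D := by
        gcongr
        calc 1 / η ≤ p / η := by gcongr
          _ ≤ (p / η) ^ p := Real.self_le_rpow_of_one_le hpη hp
  -- For p ≥ 2 the differences of signed powers involve |g| itself. With ε = η / p in Young's
  -- inequality, the resulting multiple of F is at most half of the left-hand side μ₀ F and is
  -- absorbed there.
  · have hε : 0 < η / p := by positivity
    have h1 : ∑ a : G.Dart, (signedPow (p / 2) (g a.fst) - signedPow (p / 2) (g a.snd)) ^ 2 ≤
        (p / 2) ^ 2 * ∑ a : G.Dart, ((η / p) ^ 2 * (|g a.fst| ^ p + |g a.snd| ^ p) +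
          2 * ((η / p) ^ (2 - p) * |g a.fst - g a.snd| ^ p)) := by
      rw [Finset.mul_sum]
      refine Finset.sum_le_sum fun a _ => ?_
      have h := abs_signedPow_sub_le_of_one_le (θ := p / 2) (by linarith) (g a.fst) (g a.snd)
      set x := |g a.fst - g a.snd|
      have hx : 0 ≤ x := abs_nonneg _
      have hmax : (max |g a.fst| |g a.snd| ^ (p / 2 - 1)) ^ 2 ≤
          |g a.fst| ^ (p - 2) + |g a.snd| ^ (p - 2) := by
        rw [← Real.rpow_two, ← Real.rpow_mul (by positivity)]
        rw [show (p / 2 - 1) * 2 = p - 2 by ring]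
        rcases max_cases |g a.fst| |g a.snd| with h | h <;> rw [h.1]
        · exact le_add_of_nonneg_right (by positivity)
        · exact le_add_of_nonneg_left (by positivity)
      have y₁ := sq_mul_rpow_le hp2 hε hx (abs_nonneg (g a.fst))
      have y₂ := sq_mul_rpow_le hp2 hε hx (abs_nonneg (g a.snd))
      calc _ ≤ (p / 2 * max |g a.fst| |g a.snd| ^ (p / 2 - 1) * x) ^ 2 :=
            sq_le_sq' (by linarith [abs_le.1 h]) (by linarith [abs_le.1 h])
        _ = (p / 2) ^ 2 * (x ^ 2 * (max |g a.fst| |g a.snd| ^ (p / 2 - 1)) ^ 2) := by ring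
        _ ≤ (p / 2) ^ 2 * (x ^ 2 * (|g a.fst| ^ (p - 2) + |g a.snd| ^ (p - 2))) := by gcongr
        _ ≤ _ := by
          gcongr
          linarith
    have h2 : ∑ a : G.Dart, ((η / p) ^ 2 * (|g a.fst| ^ p + |g a.snd| ^ p) +
          2 * ((η / p) ^ (2 - p) * |g a.fst - g a.snd| ^ p)) =
        2 * ((η / p) ^ 2 * (d * F) + (η / p) ^ (2 - p) * D) := by
      rw [Finset.sum_add_distrib, ← Finset.mul_sum, Finset.sum_add_distrib,
        G.sum_darts_fst hd fun v => |g v| ^ p, G.sum_darts_snd hd fun v => |g v| ^ p,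
        ← Finset.mul_sum, ← Finset.mul_sum, nsmul_eq_mul]
      ring
    rw [h2] at h1
    have h3 : (p / 2) ^ 2 * ((η / p) ^ 2 * (d * F)) ≤ μ₀ * F / 2 := by
      have : (p / 2) ^ 2 * ((η / p) ^ 2 * (d * F)) = η * (η * d) * F / 4 := by
        field_simp
        ring
      rw [this]
      have : η * (η * d) ≤ 2 * μ₀ := by
        have : 0 ≤ η * d := by positivity
        nlinarith
      nlinarith
    have h4 : (η / p) ^ (2 - p) = (p / η) ^ p * (η / p) ^ 2 := by
      rw [Real.rpow_sub hε, Real.rpow_two, ← inv_div p η, Real.inv_rpow (by positivity)]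
      field_simp
    have h5 : μ₀ * F ≤ 2 * ((p / 2) ^ 2 * ((η / p) ^ (2 - p) * D)) := by
      linarith
    have h6 : (p / 2) ^ 2 * ((η / p) ^ (2 - p) * D) = η ^ 2 / 4 * ((p / η) ^ p * D) := by
      rw [h4]
      field_simp
      ring
    rw [h6] at h5
    have h7 : 0 ≤ (p / η) ^ p * D := by positivity
    have h8 : η * (2 * d) * F ≤ η * (η / 2 * ((p / η) ^ p * D)) := by
      nlinarith
    nlinarith [le_of_mul_le_mul_left ((mul_assoc _ _ _).symm.le.trans h8) hη]

/-- A Poincaré inequality with exponent `p` on a regular graph with a spectral gap. -/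
theorem sum_abs_sub_rpow_le {d : ℕ} (hd : G.IsRegularOfDegree d) {μ₀ η p : ℝ}
    (hμ₀ : 0 < μ₀) (hμ : μ₀ ≤ G.mu₂) (hη : 0 < η) (hη1 : η ≤ 1) (hηd : η * (2 * d) ≤ μ₀)
    (hp : 1 ≤ p) (f : V → ℝ) :
    d * ∑ u, ∑ v, |f u - f v| ^ p ≤
      (2 * p / η) ^ p * Fintype.card V * ∑ a : G.Dart, |f a.fst - f a.snd| ^ p := by
  have : Nonempty V := (G.connected_of_mu₂_pos (hμ₀.trans_le hμ)).nonempty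
  obtain ⟨c, hc⟩ := exists_sum_signedPow_eq_zero (θ := p / 2) (by linarith) f
  have h := G.sum_abs_rpow_le_of_sum_signedPow_eq_zero hd hμ₀ hμ hη hη1 hηd hp hc
  simp only [sub_sub_sub_cancel_right] at h
  have h2 : ∑ u, ∑ v, |f u - f v| ^ p ≤ 2 ^ p * Fintype.card V * ∑ v, |f v - c| ^ p := by
    calc ∑ u, ∑ v, |f u - f v| ^ p
        ≤ ∑ u, ∑ v, 2 ^ (p - 1) * (|f u - c| ^ p + |f v - c| ^ p) := by
          refine Finset.sum_le_sum fun u _ => Finset.sum_le_sum fun v _ => ?_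
          calc |f u - f v| ^ p ≤ (|f u - c| + |f v - c|) ^ p := by
                gcongr
                rw [abs_sub_comm (f v)]
                exact abs_sub_le _ _ _
            _ ≤ _ := Real.add_rpow_le_two_rpow_mul (abs_nonneg _) (abs_nonneg _) hp
      _ = 2 ^ p * Fintype.card V * ∑ v, |f v - c| ^ p := by
          simp only [← Finset.mul_sum, Finset.sum_add_distrib, Finset.sum_const, Finset.card_univ,
            nsmul_eq_mul]
          rw [Real.rpow_sub_one two_ne_zero]
          ring
  calc d * ∑ u, ∑ v, |f u - f v| ^ p ≤ d * (2 ^ p * Fintype.card V * ∑ v, |f v - c| ^ p) := by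
        gcongr
    _ = 2 ^ p * Fintype.card V * (d * ∑ v, |f v - c| ^ p) := by ring
    _ ≤ 2 ^ p * Fintype.card V * ((p / η) ^ p * ∑ a : G.Dart, |f a.fst - f a.snd| ^ p) := by
        gcongr
    _ = _ := by
        rw [mul_div_assoc, Real.mul_rpow (by positivity) (by positivity)]
        ring

/-! ### Mean distance in a regular graph -/

theorem card_filter_dist_le {d : ℕ} (hd : G.IsRegularOfDegree d) (hG : G.Connected) (u : V)
    (r : ℕ) : (Finset.univ.filter fun v => G.dist u v ≤ r).card ≤ (d + 1) ^ r := by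
  induction r with
  | zero =>
    rw [pow_zero, Finset.card_le_one]
    intro a ha b hb
    simp only [Finset.mem_filter, Finset.mem_univ, true_and, Nat.le_zero] at ha hb
    rw [hG.dist_eq_zero_iff] at ha hb
    exact ha.symm.trans hb
  | succ r ih =>
    have hsub : (Finset.univ.filter fun v => G.dist u v ≤ r + 1) ⊆
        (Finset.univ.filter fun v => G.dist u v ≤ r).biUnion
          fun w => insert w (G.neighborFinset w) := by
      intro v hv
      simp only [Finset.mem_filter, Finset.mem_univ, true_and, Finset.mem_biUnion,
        Finset.mem_insert, mem_neighborFinset] at hv ⊢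
      rcases Nat.lt_or_ge r (G.dist u v) with h | h
      · obtain ⟨w, hw⟩ := hG.exists_walk_length_eq_dist v u
        cases w with
        | nil => simp at h
        | @cons _ x _ hadj w' =>
          refine ⟨x, ?_, Or.inr hadj.symm⟩
          have h1 := dist_le w'
          rw [Walk.length_cons, dist_comm] at hw
          rw [dist_comm]
          omega
      · exact ⟨v, h, Or.inl rfl⟩
    calc _ ≤ _ := Finset.card_le_card hsub
      _ ≤ (Finset.univ.filter fun v => G.dist u v ≤ r).card * (d + 1) := by
        refine Finset.card_biUnion_le_card_mul _ _ _ fun w _ => ?_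
        refine (Finset.card_insert_le _ _).trans ?_
        rw [card_neighborFinset_eq_degree, hd w]
      _ ≤ (d + 1) ^ r * (d + 1) := by gcongr
      _ = _ := (pow_succ _ _).symm

theorem log_card_mul_card_le_sum_dist {d : ℕ} (hd : G.IsRegularOfDegree d) (hG : G.Connected)
    (hd0 : 1 ≤ d) (hm : 2 ≤ Fintype.card V) (u : V) :
    Fintype.card V * Real.log (Fintype.card V) ≤
      4 * Real.log (d + 1) * ∑ v, (G.dist u v : ℝ) := by
  set m := Fintype.card V with hmdef
  -- The ball of radius r holds at most half of the vertices, so at least half lie at distance r + 1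
  -- or more. The final constant 4 comes from this half and from r + 2 ≤ 2 (r + 1).
  set r := Nat.log (d + 1) (m / 2)
  have hr1 : (d + 1) ^ r ≤ m / 2 := Nat.pow_log_le_self _ (by omega)
  have hr2 : m / 2 < (d + 1) ^ (r + 1) := Nat.lt_pow_succ_log_self (by omega) _
  have hfar : (m : ℝ) / 2 ≤ (Finset.univ.filter fun v => ¬ G.dist u v ≤ r).card := by
    have h1 := G.card_filter_dist_le hd hG u r
    have h2 := Finset.card_filter_add_card_filter_not (s := (Finset.univ : Finset V))
      (fun v => G.dist u v ≤ r)
    rw [Finset.card_univ, ← hmdef] at h2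
    rw [div_le_iff₀ two_pos]
    norm_cast
    omega
  have hsum : (m : ℝ) / 2 * (r + 1) ≤ ∑ v, (G.dist u v : ℝ) := by
    calc (m : ℝ) / 2 * (r + 1)
        ≤ (Finset.univ.filter fun v => ¬ G.dist u v ≤ r).card * ((r : ℝ) + 1) := by gcongr
      _ = ∑ v ∈ Finset.univ.filter fun v => ¬ G.dist u v ≤ r, ((r : ℝ) + 1) := by
          rw [Finset.sum_const, nsmul_eq_mul]
      _ ≤ ∑ v ∈ Finset.univ.filter fun v => ¬ G.dist u v ≤ r, (G.dist u v : ℝ) := by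
          refine Finset.sum_le_sum fun v hv => ?_
          have := (Finset.mem_filter.1 hv).2
          norm_cast
          omega
      _ ≤ _ := Finset.sum_le_sum_of_subset_of_nonneg (Finset.subset_univ _)
          fun _ _ _ => by positivity
  have hlog : Real.log m ≤ (r + 2) * Real.log (d + 1) := by
    have h1 : m ≤ (d + 1) ^ (r + 2) := by
      calc m ≤ 2 * (d + 1) ^ (r + 1) := by omega
        _ ≤ (d + 1) * (d + 1) ^ (r + 1) := by gcongr; omega
        _ = _ := (pow_succ' _ _).symm
    have h2 : (m : ℝ) ≤ ((d : ℝ) + 1) ^ (r + 2) := by exact_mod_cast h1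
    have h3 := Real.log_le_log (by positivity) h2
    rw [Real.log_pow] at h3
    exact_mod_cast h3
  have hlogd : 0 ≤ Real.log ((d : ℝ) + 1) :=
    Real.log_nonneg (by linarith [Nat.cast_nonneg (α := ℝ) d])
  calc (m : ℝ) * Real.log m ≤ m * ((r + 2) * Real.log (d + 1)) := by gcongr
    _ ≤ m * ((2 * (r + 1)) * Real.log (d + 1)) := by
      gcongr
      have : (0 : ℝ) ≤ r := Nat.cast_nonneg _
      linarith
    _ = 4 * Real.log (d + 1) * ((m : ℝ) / 2 * (r + 1)) := by ring
    _ ≤ _ := by gcongr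

end SimpleGraph

/-! ### Uniform convexity of L_p -/

/-- Scalar Clarkson inequality: superadditivity of the (p/2)-th power, the parallelogram law, then
convexity. -/
theorem abs_rpow_convexity_of_two_le {p : ℝ} (hp : 2 ≤ p) (a b : ℝ) :
    |(a + b) / 2| ^ p + |(a - b) / 2| ^ p ≤ (|a| ^ p + |b| ^ p) / 2 := by
  have hsq (x : ℝ) : |x| ^ p = (x ^ 2) ^ (p / 2) := by
    rw [← sq_abs, ← Real.rpow_two, ← Real.rpow_mul (abs_nonneg x), mul_div_cancel₀ p two_ne_zero]
  have hp' : 1 ≤ p / 2 := by linarith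
  rw [hsq, hsq, hsq a, hsq b]
  calc _ ≤ (((a + b) / 2) ^ 2 + ((a - b) / 2) ^ 2) ^ (p / 2) :=
        Real.add_rpow_le_rpow_add (sq_nonneg _) (sq_nonneg _) hp'
    _ = (a ^ 2 / 2 + b ^ 2 / 2) ^ (p / 2) := by ring_nf
    _ ≤ 2 ^ (p / 2 - 1) * ((a ^ 2 / 2) ^ (p / 2) + (b ^ 2 / 2) ^ (p / 2)) :=
        Real.add_rpow_le_two_rpow_mul (by positivity) (by positivity) hp'
    _ = _ := by
        rw [Real.div_rpow (sq_nonneg a) zero_le_two, Real.div_rpow (sq_nonneg b) zero_le_two,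
          Real.rpow_sub_one two_ne_zero]
        field_simp

theorem mul_sub_le_rpow_sub_rpow {r x y : ℝ} (hr : 0 < r) (hr1 : r ≤ 1) (hx : 0 ≤ x) (hxy : x ≤ y)
    (hy1 : y ≤ 1) : r * (y - x) ≤ y ^ r - x ^ r := by
  rcases (hx.trans hxy).eq_or_lt with rfl | hy
  · obtain rfl : x = 0 := le_antisymm hxy hx
    simp
  have h := rpow_one_add_le_one_add_mul_self (s := x / y - 1) (by
    have : 0 ≤ x / y := by positivity
    linarith) hr.le hr1
  rw [add_sub_cancel, Real.div_rpow hx hy.le, div_le_iff₀ (by positivity)] at h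
  have h2 : 1 ≤ y ^ (r - 1) := Real.one_le_rpow_of_pos_of_le_one_of_nonpos hy hy1 (by linarith)
  have h3 : y ^ r = y ^ (r - 1) * y := by rw [← Real.rpow_add_one hy.ne', sub_add_cancel]
  have h4 : (1 + r * (x / y - 1)) * y ^ r = y ^ r - r * y ^ (r - 1) * (y - x) := by
    rw [h3]
    field_simp
    ring
  have h5 : r * (y - x) * 1 ≤ r * (y - x) * y ^ (r - 1) :=
    mul_le_mul_of_nonneg_left h2 (mul_nonneg hr.le (sub_nonneg.2 hxy))
  linarith

/-- Away from 0 the second derivative is p (p - 1) (|x|^(p - 2) - 1) ≥ 0. As it does not exist at 0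
for p < 2, monotonicity of the first derivative is shown instead. -/
theorem convexOn_abs_rpow_sub_sq {p : ℝ} (hp : 1 < p) (hp2 : p ≤ 2) :
    ConvexOn ℝ (Set.Icc (-1) 1) fun x : ℝ => |x| ^ p - p * (p - 1) / 2 * x ^ 2 := by
  have hderiv (x : ℝ) : HasDerivAt (fun x : ℝ => |x| ^ p - p * (p - 1) / 2 * x ^ 2)
      (p * (|x| ^ (p - 2) * x - (p - 1) * x)) x := by
    refine ((hasDerivAt_abs_rpow x hp).sub
      ((hasDerivAt_pow 2 x).const_mul (p * (p - 1) / 2))).congr_deriv ?_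
    push_cast
    ring
  have hpos (x y : ℝ) (hx : 0 ≤ x) (hxy : x ≤ y) (hy : y ≤ 1) :
      |x| ^ (p - 2) * x - (p - 1) * x ≤ |y| ^ (p - 2) * y - (p - 1) * y := by
    have hpow (z : ℝ) (hz : 0 ≤ z) : |z| ^ (p - 2) * z = z ^ (p - 1) := by
      rw [abs_of_nonneg hz]
      rcases hz.eq_or_lt with rfl | hz
      · rw [mul_zero, Real.zero_rpow (by linarith)]
      · rw [← Real.rpow_add_one hz.ne']
        congr 1
        ring
    rw [hpow x hx, hpow y (hx.trans hxy)]
    linarith [mul_sub_le_rpow_sub_rpow (r := p - 1) (by linarith) (by linarith) hx hxy hy]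
  refine MonotoneOn.convexOn_of_deriv (convex_Icc _ _)
    (fun x _ => (hderiv x).continuousAt.continuousWithinAt)
    (fun x _ => (hderiv x).differentiableAt.differentiableWithinAt) fun x hx y hy hxy => ?_
  rw [interior_Icc] at hx hy
  rw [(hderiv x).deriv, (hderiv y).deriv]
  refine mul_le_mul_of_nonneg_left ?_ (by linarith)
  have hneg (x y : ℝ) (hy : y ≤ 0) (hxy : x ≤ y) (hx : -1 ≤ x) :
      |x| ^ (p - 2) * x - (p - 1) * x ≤ |y| ^ (p - 2) * y - (p - 1) * y := by
    have := hpos (-y) (-x) (by linarith) (by linarith) (by linarith)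
    rw [abs_neg, abs_neg] at this
    linarith
  rcases le_total 0 x with h | h
  · exact hpos x y h hxy hy.2.le
  rcases le_total y 0 with h' | h'
  · exact hneg x y h' hxy hx.1.le
  · exact (hneg x 0 le_rfl h hx.1.le).trans (hpos 0 y le_rfl h' hy.2.le)

/-- Midpoint convexity of the preceding function at a / R and b / R, where R = |a| + |b|; the
quadratic terms combine to (a - b)² by the parallelogram law. -/
theorem abs_rpow_convexity_of_le_two {p : ℝ} (hp : 1 < p) (hp2 : p ≤ 2) (a b : ℝ) :
    |(a + b) / 2| ^ p + p * (p - 1) / 8 * ((a - b) ^ 2 * (|a| + |b|) ^ (p - 2)) ≤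
      (|a| ^ p + |b| ^ p) / 2 := by
  have hR0 : 0 ≤ |a| + |b| := by positivity
  rcases hR0.eq_or_lt with hR | hR
  · have ha : a = 0 := abs_eq_zero.1 (by linarith [abs_nonneg a, abs_nonneg b])
    have hb : b = 0 := abs_eq_zero.1 (by linarith [abs_nonneg a, abs_nonneg b])
    subst ha hb
    simp [Real.zero_rpow (show p ≠ 0 by linarith)]
  set R := |a| + |b|
  have hmem (x : ℝ) (hx : |x| ≤ R) : x / R ∈ Set.Icc (-1 : ℝ) 1 := by
    rw [Set.mem_Icc, ← abs_le, abs_div, abs_of_pos hR, div_le_one hR]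
    exact hx
  have h := (convexOn_abs_rpow_sub_sq hp hp2).2 (hmem a (le_add_of_nonneg_right (abs_nonneg b)))
    (hmem b (le_add_of_nonneg_left (abs_nonneg a))) (show (0 : ℝ) ≤ 1 / 2 by norm_num)
    (show (0 : ℝ) ≤ 1 / 2 by norm_num) (by norm_num)
  simp only [smul_eq_mul] at h
  have e (x : ℝ) : |x / R| ^ p = |x| ^ p / R ^ p := by
    rw [abs_div, abs_of_pos hR, Real.div_rpow (abs_nonneg x) hR.le]
  rw [show 1 / 2 * (a / R) + 1 / 2 * (b / R) = ((a + b) / 2) / R by ring, e, e, e] at h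
  have hRp : 0 < R ^ p := by positivity
  have h2 : R ^ (p - 2) = R ^ p / R ^ 2 := by rw [Real.rpow_sub hR, Real.rpow_two]
  rw [h2]
  have h3 := mul_le_mul_of_nonneg_left h hRp.le
  have h4 : R ^ p * (|(a + b) / 2| ^ p / R ^ p - p * (p - 1) / 2 * ((a + b) / 2 / R) ^ 2) =
      |(a + b) / 2| ^ p - p * (p - 1) / 8 * ((a + b) ^ 2 * (R ^ p / R ^ 2)) := by
    field_simp
    ring
  have h5 : R ^ p * (1 / 2 * (|a| ^ p / R ^ p - p * (p - 1) / 2 * (a / R) ^ 2) +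
      1 / 2 * (|b| ^ p / R ^ p - p * (p - 1) / 2 * (b / R) ^ 2)) =
      (|a| ^ p + |b| ^ p) / 2 - p * (p - 1) / 8 * ((2 * a ^ 2 + 2 * b ^ 2) * (R ^ p / R ^ 2)) := by
    field_simp
    ring
  rw [h4, h5] at h3
  linarith

/-- An elementary form of Young's inequality. -/
theorem rpow_le_sq_mul_rpow_add {p t x s : ℝ} (hp : 1 < p) (hp2 : p ≤ 2) (ht : 0 < t)
    (hx : 0 ≤ x) (hxs : x ≤ s) :
    x ^ p ≤ t ^ (p - 2) * (x ^ 2 * s ^ (p - 2)) + t ^ p * s ^ p := by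
  have hs := hx.trans hxs
  rcases le_total x (t * s) with h | h
  · calc x ^ p ≤ (t * s) ^ p := by gcongr
      _ = t ^ p * s ^ p := Real.mul_rpow ht.le hs
      _ ≤ _ := le_add_of_nonneg_left (by positivity)
  · rcases hs.eq_or_lt with rfl | hs
    · obtain rfl : x = 0 := le_antisymm hxs hx
      simp [Real.zero_rpow (show p ≠ 0 by linarith)]
    · have hx0 : 0 < x := (mul_pos ht hs).trans_le h
      calc x ^ p = x ^ 2 * x ^ (p - 2) := by
            rw [← Real.rpow_two, ← Real.rpow_add hx0, add_sub_cancel]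
        _ ≤ x ^ 2 * (t * s) ^ (p - 2) := by
            refine mul_le_mul_of_nonneg_left ?_ (sq_nonneg x)
            exact Real.rpow_le_rpow_of_nonpos (mul_pos ht hs) h (by linarith)
        _ = t ^ (p - 2) * (x ^ 2 * s ^ (p - 2)) := by
            rw [Real.mul_rpow ht.le hs.le]
            ring
        _ ≤ _ := le_add_of_nonneg_right (by positivity)

section Lp

open MeasureTheory

variable {Ω : Type w} [MeasurableSpace Ω] {μ : Measure Ω} {p : ℝ}

/-- A constant of uniform convexity of `L_p`. -/
noncomputable def lpConvexityConst (p : ℝ) : ℝ :=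
  if 2 ≤ p then (1 / 2) ^ p else p * (p - 1) / 256

theorem lpConvexityConst_pos (hp : 1 < p) : 0 < lpConvexityConst p := by
  rw [lpConvexityConst]
  split_ifs
  · positivity
  · exact div_pos (mul_pos (by linarith) (by linarith)) (by norm_num)

theorem norm_rpow_eq_integral_of_ae (hp : 1 < p) (h : Lp ℝ (ENNReal.ofReal p) μ) {F : Ω → ℝ}
    (hF : h =ᵐ[μ] F) : Integrable (fun x => |F x| ^ p) μ ∧ ‖h‖ ^ p = ∫ x, |F x| ^ p ∂μ := by
  have hp0 : 0 < p := by linarith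
  have h0 : ENNReal.ofReal p ≠ 0 := by simpa using hp0
  have hmem : MemLp F (ENNReal.ofReal p) μ := (memLp_congr_ae hF).1 (Lp.memLp h)
  have hint := hmem.integrable_norm_rpow h0 ENNReal.ofReal_ne_top
  rw [ENNReal.toReal_ofReal hp0.le] at hint
  refine ⟨hint, ?_⟩
  rw [Lp.norm_def, eLpNorm_congr_ae hF, hmem.eLpNorm_eq_integral_rpow_norm h0 ENNReal.ofReal_ne_top,
    ENNReal.toReal_ofReal hp0.le, ENNReal.toReal_ofReal (by positivity), ← Real.rpow_mul
      (by positivity), inv_mul_cancel₀ hp0.ne', Real.rpow_one]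
  rfl

theorem norm_sub_rpow_eq_integral (hp : 1 < p) (f g : Lp ℝ (ENNReal.ofReal p) μ) :
    Integrable (fun x => |f x - g x| ^ p) μ ∧ ‖f - g‖ ^ p = ∫ x, |f x - g x| ^ p ∂μ :=
  norm_rpow_eq_integral_of_ae hp (f - g) (Lp.coeFn_sub f g)

theorem norm_midpoint_rpow_eq_integral [Fact (1 ≤ ENNReal.ofReal p)] (hp : 1 < p)
    (f g : Lp ℝ (ENNReal.ofReal p) μ) :
    Integrable (fun x => |(f x + g x) / 2| ^ p) μ ∧
      ‖(1 / 2 : ℝ) • (f + g)‖ ^ p = ∫ x, |(f x + g x) / 2| ^ p ∂μ := by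
  refine norm_rpow_eq_integral_of_ae hp _ ?_
  filter_upwards [Lp.coeFn_smul (1 / 2 : ℝ) (f + g), Lp.coeFn_add f g] with x h1 h2
  rw [h1, Pi.smul_apply, h2, Pi.add_apply, smul_eq_mul]
  ring

variable [Fact (1 ≤ ENNReal.ofReal p)]

theorem norm_midpoint_rpow_le_of_two_le (hp : 2 ≤ p) (f g : Lp ℝ (ENNReal.ofReal p) μ) :
    ‖(1 / 2 : ℝ) • (f + g)‖ ^ p + (1 / 2) ^ p * ‖f - g‖ ^ p ≤ (‖f‖ ^ p + ‖g‖ ^ p) / 2 := by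
  have hp1 : 1 < p := by linarith
  obtain ⟨i₁, e₁⟩ := norm_midpoint_rpow_eq_integral hp1 f g
  obtain ⟨i₂, e₂⟩ := norm_sub_rpow_eq_integral hp1 f g
  obtain ⟨i₃, e₃⟩ := norm_rpow_eq_integral_of_ae hp1 f (ae_eq_refl _)
  obtain ⟨i₄, e₄⟩ := norm_rpow_eq_integral_of_ae hp1 g (ae_eq_refl _)
  rw [e₁, e₂, e₃, e₄, ← integral_const_mul, ← integral_add i₁ (i₂.const_mul _),
    ← integral_add i₃ i₄, ← integral_div]
  refine integral_mono (i₁.add (i₂.const_mul _)) ((i₃.add i₄).div_const 2) fun x => ?_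
  have h := abs_rpow_convexity_of_two_le hp (f x) (g x)
  have e : |(f x - g x) / 2| ^ p = (1 / 2) ^ p * |f x - g x| ^ p := by
    rw [abs_div, div_eq_inv_mul, Real.mul_rpow (by positivity) (by positivity)]
    norm_num
  rw [e] at h
  exact h

/-- The modulus of convexity of `L_p` for `1 < p ≤ 2`, before homogenization. -/
theorem norm_sub_rpow_le_of_le_two (hp : 1 < p) (hp2 : p ≤ 2) (f g : Lp ℝ (ENNReal.ofReal p) μ)
    {t : ℝ} (ht : 0 < t) :
    ‖f - g‖ ^ p ≤ t ^ (p - 2) * (8 / (p * (p - 1)) * ((‖f‖ ^ p + ‖g‖ ^ p) / 2 -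
      ‖(1 / 2 : ℝ) • (f + g)‖ ^ p)) + t ^ p * (2 ^ p * ((‖f‖ ^ p + ‖g‖ ^ p) / 2)) := by
  obtain ⟨i₁, e₁⟩ := norm_midpoint_rpow_eq_integral hp f g
  obtain ⟨i₂, e₂⟩ := norm_sub_rpow_eq_integral hp f g
  obtain ⟨i₃, e₃⟩ := norm_rpow_eq_integral_of_ae hp f (ae_eq_refl _)
  obtain ⟨i₄, e₄⟩ := norm_rpow_eq_integral_of_ae hp g (ae_eq_refl _)
  have i₅ : Integrable (fun x => (|f x| ^ p + |g x| ^ p) / 2) μ := (i₃.add i₄).div_const 2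
  have i₆ : Integrable (fun x => (|f x| ^ p + |g x| ^ p) / 2 - |(f x + g x) / 2| ^ p) μ :=
    i₅.sub i₁
  rw [e₁, e₂, e₃, e₄, ← integral_add i₃ i₄, ← integral_div, ← integral_const_mul (2 ^ p),
    ← integral_sub i₅ i₁, ← integral_const_mul, ← integral_const_mul, ← integral_const_mul,
    ← integral_add ((i₆.const_mul _).const_mul _) ((i₅.const_mul _).const_mul _)]
  refine integral_mono i₂
    (((i₆.const_mul _).const_mul _).add ((i₅.const_mul _).const_mul _)) fun x => ?_
  have h := abs_rpow_convexity_of_le_two hp hp2 (f x) (g x)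
  have hpp : 0 < p * (p - 1) := mul_pos (by linarith) (by linarith)
  have h2 : (f x - g x) ^ 2 * (|f x| + |g x|) ^ (p - 2) ≤ 8 / (p * (p - 1)) *
      ((|f x| ^ p + |g x| ^ p) / 2 - |(f x + g x) / 2| ^ p) := by
    rw [div_mul_eq_mul_div, le_div_iff₀ hpp]
    linarith
  have h3 : (|f x| + |g x|) ^ p ≤ 2 ^ p * ((|f x| ^ p + |g x| ^ p) / 2) := by
    have := Real.add_rpow_le_two_rpow_mul (abs_nonneg (f x)) (abs_nonneg (g x)) hp.le
    rw [Real.rpow_sub_one two_ne_zero] at this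
    linarith
  calc |f x - g x| ^ p ≤ t ^ (p - 2) * (|f x - g x| ^ 2 * (|f x| + |g x|) ^ (p - 2)) +
        t ^ p * (|f x| + |g x|) ^ p :=
      rpow_le_sq_mul_rpow_add hp hp2 ht (abs_nonneg _) (abs_sub _ _)
    _ ≤ _ := by
      rw [sq_abs]
      exact add_le_add (mul_le_mul_of_nonneg_left h2 (by positivity))
        (mul_le_mul_of_nonneg_left h3 (by positivity))

/-- The bound forces y ≤ σ, so y² σ^(p - 2) ≤ y^p because p - 2 ≤ 0; then divide by σ^(p - 2). -/
theorem sq_add_sq_le_of_rpow_bound {p c δ σ y : ℝ} (hp : 1 < p) (hp2 : p ≤ 2) (hc : 0 ≤ c)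
    (hσ : 0 < σ) (hy : 0 ≤ y) (h : y ^ p ≤ σ ^ p - c * δ ^ 2 * σ ^ (p - 2)) :
    y ^ 2 + c * δ ^ 2 ≤ σ ^ 2 := by
  have hs : σ ^ p = σ ^ (p - 2) * σ ^ 2 := by
    rw [← Real.rpow_two, ← Real.rpow_add hσ, sub_add_cancel]
  have hpos : 0 < σ ^ (p - 2) := by positivity
  have hyσ : y ≤ σ := by
    refine (Real.rpow_le_rpow_iff hy hσ.le (by linarith : 0 < p)).1 (h.trans ?_)
    have : 0 ≤ c * δ ^ 2 * σ ^ (p - 2) := by positivity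
    linarith
  have hy2 : y ^ 2 * σ ^ (p - 2) ≤ y ^ p := by
    rcases hy.eq_or_lt with rfl | hy0
    · simp [Real.zero_rpow (show p ≠ 0 by linarith)]
    · calc y ^ 2 * σ ^ (p - 2) ≤ y ^ 2 * y ^ (p - 2) := mul_le_mul_of_nonneg_left
            (Real.rpow_le_rpow_of_nonpos hy0 hyσ (by linarith)) (sq_nonneg y)
        _ = y ^ p := by rw [← Real.rpow_two, ← Real.rpow_add hy0, add_sub_cancel]
  nlinarith

/-- Let σ be the p-mean of the two norms. Optimizing t gives a deficit of order δ² σ^(p - 2) for the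
p-th power of the midpoint norm; this becomes a deficit of squares, and σ² is at most the mean of
the squares. -/
theorem norm_midpoint_sq_le_of_le_two (hp : 1 < p) (hp2 : p ≤ 2)
    (f g : Lp ℝ (ENNReal.ofReal p) μ) :
    ‖(1 / 2 : ℝ) • (f + g)‖ ^ 2 + p * (p - 1) / 256 * ‖f - g‖ ^ 2 ≤ (‖f‖ ^ 2 + ‖g‖ ^ 2) / 2 := by
  have hp0 : 0 < p := by linarith
  have hpp : 0 < p * (p - 1) := mul_pos (by linarith) (by linarith)
  set S := (‖f‖ ^ p + ‖g‖ ^ p) / 2 with hS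
  have hS0 : 0 ≤ S := by positivity
  set σ := S ^ (1 / p) with hσdef
  have hσ0 : 0 ≤ σ := by positivity
  have hσp : σ ^ p = S := by
    rw [hσdef, ← Real.rpow_mul hS0, one_div, inv_mul_cancel₀ hp0.ne', Real.rpow_one]
  have hmean : σ ^ 2 ≤ (‖f‖ ^ 2 + ‖g‖ ^ 2) / 2 := by
    have h1 : 1 ≤ 2 / p := by rwa [le_div_iff₀ hp0, one_mul]
    have h2 := Real.add_rpow_le_two_rpow_mul (x := ‖f‖ ^ p / 2) (y := ‖g‖ ^ p / 2)
      (by positivity) (by positivity) h1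
    have h3 (a : ℝ) (ha : 0 ≤ a) : (a ^ p / 2) ^ (2 / p) = a ^ 2 / 2 ^ (2 / p) := by
      rw [Real.div_rpow (by positivity) zero_le_two, ← Real.rpow_mul ha,
        mul_div_cancel₀ _ hp0.ne', Real.rpow_two]
    rw [← add_div, h3 _ (norm_nonneg f), h3 _ (norm_nonneg g),
      Real.rpow_sub_one two_ne_zero] at h2
    have h4 : σ ^ 2 = S ^ (2 / p) := by
      rw [hσdef, ← Real.rpow_two, ← Real.rpow_mul hS0]
      congr 1
      ring
    rw [h4]
    refine h2.trans_eq ?_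
    field_simp
  rcases hσ0.eq_or_lt with hσ | hσ
  · have hS' : S = 0 := by rw [← hσp, ← hσ, Real.zero_rpow hp0.ne']
    have hf : ‖f‖ ^ p = 0 := by
      have : 0 ≤ ‖f‖ ^ p := by positivity
      have : 0 ≤ ‖g‖ ^ p := by positivity
      linarith
    have hg : ‖g‖ ^ p = 0 := by
      have : 0 ≤ ‖f‖ ^ p := by positivity
      have : 0 ≤ ‖g‖ ^ p := by positivity
      linarith
    rw [Real.rpow_eq_zero (norm_nonneg _) hp0.ne', norm_eq_zero] at hf hg
    simp [hf, hg]
  refine le_trans (sq_add_sq_le_of_rpow_bound hp hp2 (by positivity) hσ (norm_nonneg _) ?_) hmean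
  rw [hσp]
  rcases (norm_nonneg (f - g)).eq_or_lt with hδ | hδ
  · have hfg : f = g := by rwa [eq_comm, norm_sub_eq_zero_iff] at hδ
    subst hfg
    rw [← hδ, ← two_smul ℝ f, smul_smul]
    norm_num
    rw [hS]
    linarith
  set δ := ‖f - g‖ with hδdef
  -- This t makes the last term at most δ^p / 2, which is absorbed. The constant is 256 = 2 · 16 ·
  -- 8: the absorption, the bound 4^(p - 2) ≥ 1/16, and the pointwise inequality.
  have h := norm_sub_rpow_le_of_le_two hp hp2 f g (t := δ / (4 * σ)) (by positivity)
  rw [← hS, ← hδdef] at h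
  have h1 : (δ / (4 * σ)) ^ p * (2 ^ p * S) ≤ δ ^ p / 2 := by
    rw [← hσp, ← Real.mul_rpow zero_le_two hσ0, ← Real.mul_rpow (by positivity) (by positivity),
      show δ / (4 * σ) * (2 * σ) = δ / 2 by field_simp; ring, Real.div_rpow hδ.le zero_le_two]
    gcongr
    exact Real.self_le_rpow_of_one_le one_le_two hp.le
  have h2 : (δ / (4 * σ)) ^ (p - 2) ≤ 16 * (δ ^ p / δ ^ 2 / σ ^ (p - 2)) := by
    have h4 : (1 : ℝ) / 16 ≤ 4 ^ (p - 2) := by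
      calc (1 : ℝ) / 16 = 4 ^ (-2 : ℝ) := by
            rw [Real.rpow_neg (by norm_num), Real.rpow_two]
            norm_num
        _ ≤ 4 ^ (p - 2) := Real.rpow_le_rpow_of_exponent_le (by norm_num) (by linarith)
    rw [Real.div_rpow hδ.le (by positivity), Real.mul_rpow (by norm_num) hσ0, Real.rpow_sub hδ p,
      Real.rpow_two]
    rw [div_mul_eq_div_div, div_right_comm, div_le_iff₀ (by positivity)]
    have : 0 ≤ δ ^ p / δ ^ 2 / σ ^ (p - 2) := by positivity
    nlinarith
  set gap := S - ‖(1 / 2 : ℝ) • (f + g)‖ ^ p with hgap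
  have hpδ : 0 < δ ^ p := by positivity
  have h3 : δ ^ p / 2 ≤ (δ / (4 * σ)) ^ (p - 2) * (8 / (p * (p - 1)) * gap) := by linarith
  have hgap0 : 0 ≤ gap := by
    by_contra hneg
    have h4 : 8 / (p * (p - 1)) * gap ≤ 0 :=
      mul_nonpos_of_nonneg_of_nonpos (by positivity) (by linarith)
    have h5 := mul_nonpos_of_nonneg_of_nonpos
      (show 0 ≤ (δ / (4 * σ)) ^ (p - 2) by positivity) h4
    linarith
  have h4 : δ ^ p / 2 ≤ 16 * (δ ^ p / δ ^ 2 / σ ^ (p - 2)) * (8 / (p * (p - 1)) * gap) :=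
    h3.trans (mul_le_mul_of_nonneg_right h2 (by positivity))
  have hσ2 : 0 < σ ^ (p - 2) := by positivity
  have h5 : 16 * (δ ^ p / δ ^ 2 / σ ^ (p - 2)) * (8 / (p * (p - 1)) * gap) =
      δ ^ p / 2 * (gap / (p * (p - 1) / 256 * δ ^ 2 * σ ^ (p - 2))) := by
    field_simp
    ring
  rw [h5] at h4
  have h6 := (le_mul_iff_one_le_right (by positivity)).1 h4
  rw [one_le_div (by positivity)] at h6
  linarith

theorem norm_midpoint_rpow_le (hp : 1 < p) (f g : Lp ℝ (ENNReal.ofReal p) μ) :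
    ‖(1 / 2 : ℝ) • (f + g)‖ ^ max p 2 + lpConvexityConst p * ‖f - g‖ ^ max p 2 ≤
      (‖f‖ ^ max p 2 + ‖g‖ ^ max p 2) / 2 := by
  rw [lpConvexityConst]
  split_ifs with h
  · rw [max_eq_left h]
    exact norm_midpoint_rpow_le_of_two_le h f g
  · rw [max_eq_right (not_le.1 h).le]
    simp only [Real.rpow_two]
    exact norm_midpoint_sq_le_of_le_two hp (not_le.1 h).le f g

end Lp

theorem rpow_average_le {ι : Type*} [Fintype ι] [Nonempty ι] {z : ι → ℝ} (hz : ∀ i, 0 ≤ z i)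
    {r : ℝ} (hr : 1 ≤ r) :
    ((∑ i, z i) / Fintype.card ι) ^ r ≤ (∑ i, z i ^ r) / Fintype.card ι := by
  have h := Real.rpow_arith_mean_le_arith_mean_rpow Finset.univ
    (fun _ : ι => (1 : ℝ) / Fintype.card ι) z (fun _ _ => by positivity) (by simp)
    (fun i _ => hz i) hr
  rw [← Finset.mul_sum, ← Finset.mul_sum] at h
  rwa [div_eq_inv_mul, div_eq_inv_mul, ← one_div]

/-! ### Poincaré inequality and edge stretch for maps into L_p -/

namespace SimpleGraph

open MeasureTheory

variable {V : Type u} [Fintype V] [DecidableEq V] (G : SimpleGraph V) [DecidableRel G.Adj]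

variable {Ω : Type w} [MeasurableSpace Ω] {μ : Measure Ω} {p : ℝ}

/-- Both sides are integrals of the scalar inequality at the points of Ω. -/
theorem sum_norm_sub_rpow_le {d : ℕ} (hd : G.IsRegularOfDegree d) {μ₀ η : ℝ}
    (hμ₀ : 0 < μ₀) (hμ : μ₀ ≤ G.mu₂) (hη : 0 < η) (hη1 : η ≤ 1) (hηd : η * (2 * d) ≤ μ₀)
    (hp : 1 < p) (h : V → Lp ℝ (ENNReal.ofReal p) μ) :
    d * ∑ u, ∑ v, ‖h u - h v‖ ^ p ≤
      (2 * p / η) ^ p * Fintype.card V * ∑ a : G.Dart, ‖h a.fst - h a.snd‖ ^ p := by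
  have hint (u v : V) := (norm_sub_rpow_eq_integral hp (h u) (h v)).1
  simp only [fun u v => (norm_sub_rpow_eq_integral hp (h u) (h v)).2]
  have i₁ : Integrable (fun x => ∑ a : G.Dart, |h a.fst x - h a.snd x| ^ p) μ :=
    integrable_finsetSum _ fun a _ => hint _ _
  have i₂ (u : V) : Integrable (fun x => ∑ v, |h u x - h v x| ^ p) μ :=
    integrable_finsetSum _ fun v _ => hint _ _
  have i₃ : Integrable (fun x => ∑ u, ∑ v, |h u x - h v x| ^ p) μ :=
    integrable_finsetSum _ fun u _ => i₂ u
  simp only [← integral_finsetSum Finset.univ fun v _ => hint _ v]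
  rw [← integral_finsetSum Finset.univ fun u _ => i₂ u,
    ← integral_finsetSum Finset.univ fun (a : G.Dart) _ => hint a.fst a.snd,
    ← integral_const_mul, ← integral_const_mul]
  exact integral_mono (i₃.const_mul _) (i₁.const_mul _) fun x =>
    G.sum_abs_sub_rpow_le hd hμ₀ hμ hη hη1 hηd hp.le fun v => h v x

/-- Under a Poincaré inequality with exponent `p`, the average stretch of the edges in an embedding
of a regular graph is at least logarithmic in the number of vertices. -/
theorem rpow_le_average_dart {E : Type*} [NormedAddCommGroup E] {d : ℕ}
    (hd : G.IsRegularOfDegree d) (hd0 : 1 ≤ d) (hm : 2 ≤ Fintype.card V) (hconn : G.Connected)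
    {p q K M : ℝ} (hp : 1 < p) (hq : p ≤ q) (hK : 0 < K) (hM : 0 < M) (h : V → E)
    (hP : d * ∑ u, ∑ v, ‖h u - h v‖ ^ p ≤
      K ^ p * Fintype.card V * ∑ a : G.Dart, ‖h a.fst - h a.snd‖ ^ p)
    (hh : ∀ u v, (G.dist u v : ℝ) ≤ M * ‖h u - h v‖) :
    (Real.log (Fintype.card V) / (4 * Real.log (d + 1)) / (K * M)) ^ q ≤
      (∑ a : G.Dart, ‖h a.fst - h a.snd‖ ^ q) / Fintype.card G.Dart := by
  have hp0 : 0 < p := by linarith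
  have hne : Nonempty V := hconn.nonempty
  have hcardD : (Fintype.card G.Dart : ℝ) = d * Fintype.card V := by
    exact_mod_cast G.card_dart_of_regular hd
  have hneD : Nonempty G.Dart := by
    refine Fintype.card_pos_iff.1 ?_
    rw [G.card_dart_of_regular hd]
    positivity
  have hm0 : (0 : ℝ) < Fintype.card V := by positivity
  have hd0' : (0 : ℝ) < d := by exact_mod_cast hd0
  have hlogd : 0 < Real.log ((d : ℝ) + 1) := Real.log_pos (by linarith)
  have hlogm : 0 ≤ Real.log (Fintype.card V) := Real.log_natCast_nonneg _
  set Λ := Real.log (Fintype.card V) / (4 * Real.log (d + 1)) with hΛ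
  have hΛ0 : 0 ≤ Λ := by positivity
  have h1 : (Λ / M) ^ p ≤ (∑ z : V × V, ‖h z.1 - h z.2‖ ^ p) / Fintype.card (V × V) := by
    refine le_trans ?_ (rpow_average_le (fun z : V × V => norm_nonneg (h z.1 - h z.2)) hp.le)
    refine Real.rpow_le_rpow (by positivity) ?_ hp0.le
    have hsum : Fintype.card V * (Fintype.card V * Real.log (Fintype.card V)) ≤
        4 * Real.log (d + 1) * ∑ u, ∑ v, (G.dist u v : ℝ) := by
      calc _ = ∑ u : V, (Fintype.card V * Real.log (Fintype.card V)) := by simp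
        _ ≤ ∑ u, 4 * Real.log (d + 1) * ∑ v, (G.dist u v : ℝ) :=
          Finset.sum_le_sum fun u _ => G.log_card_mul_card_le_sum_dist hd hconn hd0 hm u
        _ = _ := by rw [Finset.mul_sum]
    have hsum2 : ∑ u, ∑ v, (G.dist u v : ℝ) ≤ M * ∑ z : V × V, ‖h z.1 - h z.2‖ := by
      rw [Fintype.sum_prod_type, Finset.mul_sum]
      refine Finset.sum_le_sum fun u _ => ?_
      rw [Finset.mul_sum]
      exact Finset.sum_le_sum fun v _ => hh u v
    rw [Fintype.card_prod, Nat.cast_mul, le_div_iff₀ (by positivity), hΛ, div_div,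
      div_mul_eq_mul_div, div_le_iff₀ (by positivity)]
    calc _ = Fintype.card V * (Fintype.card V * Real.log (Fintype.card V)) := by ring
      _ ≤ _ := hsum
      _ ≤ 4 * Real.log (d + 1) * (M * ∑ z : V × V, ‖h z.1 - h z.2‖) := by gcongr
      _ = _ := by ring
  rw [Fintype.sum_prod_type] at h1
  have h3 : (Λ / (K * M)) ^ p ≤
      (∑ a : G.Dart, ‖h a.fst - h a.snd‖ ^ p) / Fintype.card G.Dart := by
    have e : (Λ / (K * M)) ^ p = (Λ / M) ^ p / K ^ p := by
      rw [← Real.div_rpow (by positivity) (by positivity)]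
      congr 1
      field_simp
    rw [e, div_le_iff₀ (by positivity)]
    refine h1.trans ?_
    rw [hcardD, Fintype.card_prod, Nat.cast_mul, div_mul_eq_mul_div,
      div_le_div_iff₀ (by positivity) (by positivity)]
    have h5 := mul_le_mul_of_nonneg_right hP hm0.le
    calc _ = d * (∑ u, ∑ v, ‖h u - h v‖ ^ p) * Fintype.card V := by ring
      _ ≤ _ := h5
      _ = _ := by ring
  -- The Poincaré inequality has exponent p and convexity has exponent q ≥ p; the power mean
  -- inequality passes from one to the other.
  have hqp : 1 ≤ q / p := by rwa [one_le_div hp0]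
  have hpow (x : ℝ) (hx : 0 ≤ x) : (x ^ p) ^ (q / p) = x ^ q := by
    rw [← Real.rpow_mul hx, mul_div_cancel₀ _ hp0.ne']
  calc _ = ((Λ / (K * M)) ^ p) ^ (q / p) := (hpow _ (by positivity)).symm
    _ ≤ ((∑ a : G.Dart, ‖h a.fst - h a.snd‖ ^ p) / Fintype.card G.Dart) ^ (q / p) :=
      Real.rpow_le_rpow (by positivity) h3 (by linarith)
    _ ≤ _ := rpow_average_le (fun a => by positivity) hqp
    _ = _ := by simp only [fun a : G.Dart => hpow _ (norm_nonneg (h a.fst - h a.snd))]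

end SimpleGraph

/-! ### Convexity gain between consecutive layers -/

namespace SimpleGraph

variable {V : Type u} [Fintype V] (G : SimpleGraph V) [DecidableRel G.Adj]
  {E : Type*} [NormedAddCommGroup E] [NormedSpace ℝ E]

/-- Convexity gain for the maps between consecutive layers of the stretched graph. -/
theorem norm_average_sub_rpow_add_le {d : ℕ} (hd : G.IsRegularOfDegree d) [Nonempty G.Dart]
    {q κ : ℝ} (hq : 1 ≤ q)
    (hE : ∀ x y : E, ‖(1 / 2 : ℝ) • (x + y)‖ ^ q + κ * ‖x - y‖ ^ q ≤ (‖x‖ ^ q + ‖y‖ ^ q) / 2)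
    (A B : V → E) :
    ‖(1 / Fintype.card V : ℝ) • ∑ v, B v - (1 / Fintype.card V : ℝ) • ∑ v, A v‖ ^ q +
        κ * ((∑ a : G.Dart, ‖B a.fst - B a.snd‖ ^ q) / Fintype.card G.Dart) ≤
      ((∑ v, ‖A v - B v‖ ^ q) / Fintype.card V +
        (∑ a : G.Dart, ‖A a.fst - B a.snd‖ ^ q) / Fintype.card G.Dart) / 2 := by
  have hD0 : (0 : ℝ) < Fintype.card G.Dart := by positivity
  have hcardD : (Fintype.card G.Dart : ℝ) = d * Fintype.card V := by
    exact_mod_cast G.card_dart_of_regular hd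
  have hd0 : (d : ℝ) ≠ 0 := fun h => by rw [hcardD, h, zero_mul] at hD0; exact hD0.false
  have hm0 : (Fintype.card V : ℝ) ≠ 0 := fun h => by
    rw [hcardD, h, mul_zero] at hD0; exact hD0.false
  -- Midpoint of the straight edge and the cross edge leaving the first endpoint of the dart. By
  -- regularity both ends of a random dart are uniform, so the mean of X is the difference of the
  -- centroids.
  let X (a : G.Dart) : E := (1 / 2 : ℝ) • ((B a.fst - A a.fst) + (B a.snd - A a.fst))
  have hmean : (1 / Fintype.card V : ℝ) • ∑ v, B v - (1 / Fintype.card V : ℝ) • ∑ v, A v =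
      (1 / Fintype.card G.Dart : ℝ) • ∑ a, X a := by
    have e : ∑ a, X a = (d : ℝ) • (∑ v, B v - ∑ v, A v) := by
      simp only [X, ← Finset.smul_sum, Finset.sum_add_distrib, Finset.sum_sub_distrib,
        G.sum_darts_fst hd, G.sum_darts_snd hd]
      rw [← two_smul ℝ (d • ∑ v, B v - d • ∑ v, A v), smul_smul]
      norm_num
      rw [← smul_sub, Nat.cast_smul_eq_nsmul]
    rw [e, smul_smul, hcardD, ← smul_sub]
    congr 1
    field_simp
  have hjensen : ‖(1 / Fintype.card G.Dart : ℝ) • ∑ a, X a‖ ^ q ≤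
      (∑ a, ‖X a‖ ^ q) / Fintype.card G.Dart := by
    refine le_trans ?_ (rpow_average_le (fun a => norm_nonneg (X a)) hq)
    refine Real.rpow_le_rpow (norm_nonneg _) ?_ (by linarith)
    rw [norm_smul, Real.norm_of_nonneg (by positivity), one_div, div_eq_inv_mul]
    gcongr
    exact norm_sum_le _ _
  have hstep (a : G.Dart) : ‖X a‖ ^ q + κ * ‖B a.fst - B a.snd‖ ^ q ≤
      (‖A a.fst - B a.fst‖ ^ q + ‖A a.fst - B a.snd‖ ^ q) / 2 := by
    have h := hE (B a.fst - A a.fst) (B a.snd - A a.fst)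
    rwa [sub_sub_sub_cancel_right, norm_sub_rev _ (A a.fst), norm_sub_rev _ (A a.fst)] at h
  have hsum := Finset.sum_le_sum fun a (_ : a ∈ Finset.univ) => hstep a
  rw [Finset.sum_add_distrib, ← Finset.mul_sum, ← Finset.sum_div, Finset.sum_add_distrib,
    G.sum_darts_fst hd fun v => ‖A v - B v‖ ^ q, nsmul_eq_mul] at hsum
  have e2 : (∑ v, ‖A v - B v‖ ^ q) / Fintype.card V =
      d * (∑ v, ‖A v - B v‖ ^ q) / Fintype.card G.Dart := by
    rw [hcardD]
    field_simp
  rw [hmean, e2]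
  calc _ ≤ (∑ a, ‖X a‖ ^ q) / Fintype.card G.Dart +
        κ * ((∑ a : G.Dart, ‖B a.fst - B a.snd‖ ^ q) / Fintype.card G.Dart) := by gcongr
    _ = (∑ a, ‖X a‖ ^ q + κ * ∑ a : G.Dart, ‖B a.fst - B a.snd‖ ^ q) / Fintype.card G.Dart := by
      ring
    _ ≤ (_) / (Fintype.card G.Dart : ℝ) := div_le_div_of_nonneg_right hsum hD0.le
    _ = _ := by ring

end SimpleGraph

theorem norm_sub_last_le_sum {E : Type*} [SeminormedAddCommGroup E] {n : ℕ} (a : Fin (n + 1) → E) :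
    ‖a 0 - a (Fin.last n)‖ ≤ ∑ i : Fin n, ‖a i.succ - a i.castSucc‖ := by
  induction n with
  | zero => simp
  | succ n ih =>
    rw [Fin.sum_univ_castSucc]
    have h := ih fun i => a i.castSucc
    have h2 := norm_sub_le_norm_sub_add_norm_sub (a 0) (a (Fin.last n).castSucc)
      (a (Fin.last (n + 1)))
    rw [norm_sub_rev (a (Fin.last n).castSucc)] at h2
    exact h2.trans (add_le_add h le_rfl)

/-- The weights are the shares of the five segments (tail, start, layers, finish, tail) in the
length 9 D of `tilde`. -/
theorem rpow_mean_five_le {q : ℝ} (hq : 1 ≤ q) {x : Fin 5 → ℝ} (hx : ∀ i, 0 ≤ x i) :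
    (1 / 3 * x 0 + 1 / 9 * x 1 + 1 / 9 * x 2 + 1 / 9 * x 3 + 1 / 3 * x 4) ^ q ≤
      1 / 3 * x 0 ^ q + 1 / 9 * x 1 ^ q + 1 / 9 * x 2 ^ q + 1 / 9 * x 3 ^ q + 1 / 3 * x 4 ^ q := by
  have h := Real.rpow_arith_mean_le_arith_mean_rpow Finset.univ
    ![(1 : ℝ) / 3, 1 / 9, 1 / 9, 1 / 9, 1 / 3] x
    (fun i _ => by fin_cases i <;> simp) (by simp [Fin.sum_univ_succ]; norm_num)
    (fun i _ => hx i) hq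
  simpa [Fin.sum_univ_five] using h

theorem norm_sub_average_rpow_le {ι E : Type*} [Fintype ι] [Nonempty ι] [NormedAddCommGroup E]
    [NormedSpace ℝ E] {q D : ℝ} (hq : 1 ≤ q) (hD : 0 ≤ D) (x : E) (y : ι → E) :
    (‖x - (1 / Fintype.card ι : ℝ) • ∑ i, y i‖ / D) ^ q ≤
      (∑ i, (‖x - y i‖ / D) ^ q) / Fintype.card ι := by
  refine le_trans ?_ (rpow_average_le (fun i => by positivity) hq)
  refine Real.rpow_le_rpow (by positivity) ?_ (by linarith)
  have h : x - (1 / Fintype.card ι : ℝ) • ∑ i, y i =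
      (1 / Fintype.card ι : ℝ) • ∑ i, (x - y i) := by
    rw [Finset.sum_sub_distrib, smul_sub, Finset.sum_const, Finset.card_univ,
      ← Nat.cast_smul_eq_nsmul ℝ, smul_smul, one_div_mul_cancel (by positivity), one_smul]
  rw [h, norm_smul, Real.norm_of_nonneg (by positivity), ← Finset.sum_div, div_right_comm,
    one_div_mul_eq_div]
  gcongr
  exact norm_sum_le _ _

/-! ### Edges, weights and potentials of the stretched graph with tails -/

namespace SimpleGraph

section Edges

variable {V : Type u} (G : SimpleGraph V)

/-- The edges of the stretched graph, as a disjoint union. -/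
def stretchedEdgeEquiv (D : ℕ) : StretchedEdge G D ≃
    V ⊕ V ⊕ (Fin (D + 1) × G.edgeSet) ⊕ (Fin D × V) ⊕ (Fin D × G.Dart) where
  toFun
    | .start v => Sum.inl v
    | .finish v => Sum.inr (Sum.inl v)
    | .vertical j e => Sum.inr (Sum.inr (Sum.inl (j, e)))
    | .straight i v => Sum.inr (Sum.inr (Sum.inr (Sum.inl (i, v))))
    | .cross i a => Sum.inr (Sum.inr (Sum.inr (Sum.inr (i, a))))
  invFun
    | Sum.inl v => .start v
    | Sum.inr (Sum.inl v) => .finish v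
    | Sum.inr (Sum.inr (Sum.inl (j, e))) => .vertical j e
    | Sum.inr (Sum.inr (Sum.inr (Sum.inl (i, v)))) => .straight i v
    | Sum.inr (Sum.inr (Sum.inr (Sum.inr (i, a)))) => .cross i a
  left_inv e := by cases e <;> rfl
  right_inv e := by
    rcases e with v | v | ⟨j, e⟩ | ⟨i, v⟩ | ⟨i, a⟩ <;> rfl

variable [Fintype V] [DecidableRel G.Adj]

instance (D : ℕ) : Fintype (StretchedEdge G D) :=
  Fintype.ofEquiv _ (G.stretchedEdgeEquiv D).symm

noncomputable instance : Fintype G.tilde.E :=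
  inferInstanceAs (Fintype (StretchedEdge G G.diam ⊕ ULift.{u} Bool))

theorem sum_tilde_edges (F : StretchedEdge G G.diam ⊕ ULift.{u} Bool → ℝ) :
    ∑ e : G.tilde.E, F e = F (Sum.inr ⟨false⟩) + F (Sum.inr ⟨true⟩) +
      ∑ v, F (Sum.inl (.start v)) + ∑ v, F (Sum.inl (.finish v)) +
      ∑ j, ∑ e, F (Sum.inl (.vertical j e)) +
      ∑ i, ∑ v, F (Sum.inl (.straight i v)) + ∑ i, ∑ a, F (Sum.inl (.cross i a)) := by
  refine (Fintype.sum_sum_type F).trans ?_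
  rw [Fintype.sum_equiv Equiv.ulift (fun b : ULift.{u} Bool => F (Sum.inr b))
      (fun b => F (Sum.inr ⟨b⟩)) (fun b => rfl), Fintype.sum_bool,
    Fintype.sum_equiv (G.stretchedEdgeEquiv G.diam) (fun e => F (Sum.inl e))
      (fun e => F (Sum.inl ((G.stretchedEdgeEquiv G.diam).symm e))) (fun e => by simp)]
  simp only [Fintype.sum_sum_type, Fintype.sum_prod_type]
  simp only [stretchedEdgeEquiv, Equiv.coe_fn_symm_mk]
  ring

/-- The probability that a random geodesic from `s` to `t` has a given edge at a random point. -/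
noncomputable def tildeWeight : StretchedEdge G G.diam ⊕ ULift.{u} Bool → ℝ
  | Sum.inl (.start _) => 1 / 9 / Fintype.card V
  | Sum.inl (.finish _) => 1 / 9 / Fintype.card V
  | Sum.inl (.vertical _ _) => 0
  | Sum.inl (.straight _ _) => 1 / 18 / G.diam / Fintype.card V
  | Sum.inl (.cross _ _) => 1 / 18 / G.diam / Fintype.card G.Dart
  | Sum.inr _ => 1 / 3

theorem tildeWeight_nonneg (e : G.tilde.E) : 0 ≤ G.tildeWeight e := by
  rcases e with (_ | _ | _ | _ | _) | _ <;> simp only [tildeWeight] <;> positivity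

theorem sum_tildeWeight [Nonempty V] [Nonempty G.Dart] (hD : 1 ≤ G.diam) :
    ∑ e : G.tilde.E, G.tildeWeight e = 1 := by
  have hD0 : (G.diam : ℝ) ≠ 0 := by positivity
  have hm0 : (Fintype.card V : ℝ) ≠ 0 := by positivity
  have ha0 : (Fintype.card G.Dart : ℝ) ≠ 0 := by positivity
  rw [sum_tilde_edges]
  simp only [tildeWeight, Finset.sum_const, Finset.card_univ, Fintype.card_fin, nsmul_eq_mul]
  field_simp
  norm_num

end Edges

section Metric

variable {V : Type u} (G : SimpleGraph V)

theorem len_tilde_pos (hD : 1 ≤ G.diam) (e : G.tilde.E) : 0 < G.tilde.len e := by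
  have hD0 : (0 : ℝ≥0) < G.diam := by exact_mod_cast hD
  rcases e with (_ | _ | _ | _ | _) | _
  all_goals simp only [tilde, stretched, STGraph.withTails]; positivity

/-- The position of a vertex along the geodesics from `s` to `t`. -/
noncomputable def tildeHeight : StretchedVertex V G.diam ⊕ ULift.{u} Bool → ℝ
  | Sum.inr ⟨false⟩ => 0
  | Sum.inl .s => 1 / 3
  | Sum.inl (.layer i _) => 4 / 9 + i / G.diam / 9
  | Sum.inl .t => 2 / 3
  | Sum.inr ⟨true⟩ => 1

theorem tildeHeight_le_len (hD : 1 ≤ G.diam) (e : G.tilde.E) :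
    |G.tildeHeight (G.tilde.src e) - G.tildeHeight (G.tilde.tgt e)| * (9 * G.diam) ≤
      G.tilde.len e := by
  have hD0 : (0 : ℝ) < G.diam := by exact_mod_cast hD
  rw [← abs_of_pos (show (0 : ℝ) < 9 * G.diam by positivity), ← abs_mul]
  rcases e with (_ | _ | _ | ⟨i, _⟩ | ⟨i, _⟩) | ⟨_ | _⟩
  all_goals simp only [tilde, stretched, STGraph.withTails, tildeHeight]
  all_goals push_cast
  all_goals try rw [Fin.val_castSucc, Fin.val_succ]
  all_goals push_cast
  · rw [abs_le]; constructor <;> norm_num <;> linarith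
  · rw [div_self hD0.ne', abs_le]; constructor <;> linarith
  · simp
  · rw [show (4 / 9 + (i : ℝ) / G.diam / 9 - (4 / 9 + ((i : ℝ) + 1) / G.diam / 9)) * (9 * G.diam)
      = -1 by field_simp; ring]
    simp
  · rw [show (4 / 9 + (i : ℝ) / G.diam / 9 - (4 / 9 + ((i : ℝ) + 1) / G.diam / 9)) * (9 * G.diam)
      = -1 by field_simp; ring]
    simp
  · rw [abs_le]; constructor <;> linarith
  · rw [abs_le]; constructor <;> linarith

theorem hasWalk_layer (v : V) (i : Fin (G.diam + 1)) :
    G.tilde.HasWalk (Sum.inl (.layer 0 v)) (Sum.inl (.layer i v)) i := by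
  induction i using Fin.induction with
  | zero => simpa using STGraph.HasWalk.nil _
  | succ i ih =>
    have h := ih.append (G.tilde.hasWalk_edge (Sum.inl (.straight i v)))
    have e : ((i.castSucc : ℕ) : ℝ≥0) + G.tilde.len (Sum.inl (.straight i v)) =
        ((i.succ : ℕ) : ℝ≥0) := by
      simp [tilde, stretched, STGraph.withTails]
    rwa [e] at h

/-- An explicit walk through copies of one vertex bounds the length from above; the scaled height is
a potential and bounds it from below. -/
theorem length_tilde [Nonempty V] (hD : 1 ≤ G.diam) : G.tilde.length = 9 * G.diam := by
  have hle : G.tilde.pathDist G.tilde.s G.tilde.t ≤ ((9 * G.diam : ℝ≥0) : ℝ≥0∞) := by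
    obtain ⟨v⟩ := ‹Nonempty V›
    refine STGraph.pathDist_le ?_
    have h₁ : G.tilde.HasWalk G.tilde.s (Sum.inl .s) _ := G.tilde.hasWalk_edge (Sum.inr ⟨false⟩)
    have h₂ : G.tilde.HasWalk (Sum.inl .s) (Sum.inl (.layer 0 v)) _ :=
      G.tilde.hasWalk_edge (Sum.inl (.start v))
    have h₃ : G.tilde.HasWalk (Sum.inl (.layer (Fin.last _) v)) (Sum.inl .t) _ :=
      G.tilde.hasWalk_edge (Sum.inl (.finish v))
    have h₄ : G.tilde.HasWalk (Sum.inl .t) G.tilde.t _ := G.tilde.hasWalk_edge (Sum.inr ⟨true⟩)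
    have h := (((h₁.append h₂).append (G.hasWalk_layer v (Fin.last _))).append h₃).append h₄
    convert h using 1
    simp only [tilde, stretched, STGraph.withTails, Fin.val_last]
    ring
  have hge : ((9 * G.diam : ℝ≥0) : ℝ≥0∞) ≤ G.tilde.pathDist G.tilde.s G.tilde.t := by
    have hpot : G.tilde.IsPotential fun x => G.tildeHeight x * (9 * G.diam) := fun e => by
      rw [← sub_mul, abs_mul, abs_of_nonneg (show (0 : ℝ) ≤ 9 * G.diam by positivity)]
      exact G.tildeHeight_le_len hD e
    have h := hpot.ofReal_le_pathDist G.tilde.s G.tilde.t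
    refine le_trans (le_of_eq ?_) h
    rw [← ENNReal.ofReal_coe_nnreal]
    congr 1
    simp [tilde, STGraph.withTails, tildeHeight]
  rw [STGraph.length, le_antisymm hle hge, ENNReal.toNNReal_coe]

theorem isHeight_tildeHeight [Nonempty V] (hD : 1 ≤ G.diam) :
    G.tilde.IsHeight G.tildeHeight where
  s_eq := rfl
  t_eq := rfl
  le_len e := by
    rw [G.length_tilde hD]
    push_cast
    exact G.tildeHeight_le_len hD e

/-- The distance in `G` to the vertex `u`, in every layer. -/
noncomputable def layerDist (u : V) : StretchedVertex V G.diam ⊕ ULift.{u} Bool → ℝ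
  | Sum.inl (.layer _ v) => G.dist u v
  | Sum.inl .s => G.diam
  | Sum.inl .t => G.diam
  | Sum.inr _ => G.diam

theorem abs_dist_sub_dist_le (hG : G.Connected) (u : V) {v w : V} (h : G.Adj v w) :
    |(G.dist u v : ℝ) - G.dist u w| ≤ 1 := by
  have h1 := hG.dist_triangle (u := u) (v := v) (w := w)
  have h2 := hG.dist_triangle (u := u) (v := w) (w := v)
  rw [dist_eq_one_iff_adj.2 h] at h1
  rw [dist_eq_one_iff_adj.2 h.symm] at h2
  have h1' : (G.dist u w : ℝ) ≤ G.dist u v + 1 := by exact_mod_cast h1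
  have h2' : (G.dist u v : ℝ) ≤ G.dist u w + 1 := by exact_mod_cast h2
  rw [abs_le]
  constructor <;> linarith

/-- The value diam G outside the layers differs from any distance by at most diam G, the length of
the edges at s' and t'. It also makes the values at s and t agree, as `Gains` requires. -/
theorem isPotential_layerDist [Finite V] (hG : G.Connected) (u : V) :
    G.tilde.IsPotential (G.layerDist u) := by
  have : Nonempty V := hG.nonempty
  have hdiam (v : V) : (G.dist u v : ℝ) ≤ G.diam := by
    exact_mod_cast dist_le_diam (connected_iff_ediam_ne_top.1 hG)
  have hnn (v : V) : (0 : ℝ) ≤ G.dist u v := Nat.cast_nonneg _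
  intro e
  rcases e with (v | v | ⟨j, e⟩ | ⟨i, v⟩ | ⟨i, a⟩) | ⟨_ | _⟩
  all_goals simp only [tilde, stretched, STGraph.withTails, layerDist]
  all_goals push_cast
  · rw [abs_le]; constructor <;> linarith [hdiam v, hnn v]
  · rw [abs_le]; constructor <;> linarith [hdiam v, hnn v]
  · refine G.abs_dist_sub_dist_le hG u ?_
    have h := e.2
    rw [← Quot.out_eq e.1] at h
    exact h
  · simp
  · exact G.abs_dist_sub_dist_le hG u a.adj
  · simp
  · simp

end Metric

end SimpleGraph

/-! ### The gain of the stretched graph with tails -/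

namespace SimpleGraph

variable {V : Type u} [Fintype V] (G : SimpleGraph V) [DecidableRel G.Adj]
  {E : Type*} [NormedAddCommGroup E]

theorem energy_tilde_eq (q : ℝ) (g : StretchedVertex V G.diam ⊕ ULift.{u} Bool → E) :
    G.tilde.energy G.tildeWeight q g =
      1 / 3 * (‖g (Sum.inr ⟨false⟩) - g (Sum.inl .s)‖ / (3 * G.diam)) ^ q +
      1 / 9 * ((∑ v, (‖g (Sum.inl .s) - g (Sum.inl (.layer 0 v))‖ / G.diam) ^ q) /
        Fintype.card V) +
      1 / 9 * ((∑ i : Fin G.diam,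
        ((∑ v, ‖g (Sum.inl (.layer i.castSucc v)) - g (Sum.inl (.layer i.succ v))‖ ^ q) /
            Fintype.card V +
          (∑ a : G.Dart, ‖g (Sum.inl (.layer i.castSucc a.fst)) -
            g (Sum.inl (.layer i.succ a.snd))‖ ^ q) / Fintype.card G.Dart) / 2) / G.diam) +
      1 / 9 * ((∑ v, (‖g (Sum.inl .t) - g (Sum.inl (.layer (Fin.last _) v))‖ / G.diam) ^ q) /
        Fintype.card V) +
      1 / 3 * (‖g (Sum.inl .t) - g (Sum.inr ⟨true⟩)‖ / (3 * G.diam)) ^ q := by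
  refine (G.sum_tilde_edges fun e => G.tildeWeight e *
    (‖g (G.tilde.src e) - g (G.tilde.tgt e)‖ / G.tilde.len e) ^ q).trans ?_
  simp only [tildeWeight, tilde, stretched, STGraph.withTails, zero_mul, Finset.sum_const_zero,
    ← Finset.mul_sum, ← Finset.sum_div, NNReal.coe_one, div_one, NNReal.coe_natCast,
    NNReal.coe_mul, NNReal.coe_ofNat, Finset.sum_add_distrib]
  simp only [fun v => norm_sub_rev (g (Sum.inl (.layer (Fin.last G.diam) v))) (g (Sum.inl .t))]
  ring

variable [NormedSpace ℝ E]

/-- The stretched graph with tails gains over its edges, if the Poincaré inequality forces the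
edges of a layer to be stretched. -/
theorem gains_tilde {d : ℕ} (hd : G.IsRegularOfDegree d) [Nonempty G.Dart] (hG : G.Connected)
    (hD : 1 ≤ G.diam) {q κ M δ : ℝ} (hq : 1 ≤ q) (hκ : 0 ≤ κ)
    (hE : ∀ x y : E, ‖(1 / 2 : ℝ) • (x + y)‖ ^ q + κ * ‖x - y‖ ^ q ≤ (‖x‖ ^ q + ‖y‖ ^ q) / 2)
    (hδ : ∀ h : V → E, (∀ u v, (G.dist u v : ℝ) ≤ M * ‖h u - h v‖) →
      δ ≤ (∑ a : G.Dart, ‖h a.fst - h a.snd‖ ^ q) / Fintype.card G.Dart) :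
    G.tilde.Gains E G.tildeWeight q M (κ * δ / 9) := by
  have : Nonempty V := hG.nonempty
  have : Nonempty (Fin G.diam) := ⟨⟨0, hD⟩⟩
  have hD0 : (0 : ℝ) < G.diam := by exact_mod_cast hD
  intro g hg
  change StretchedVertex V G.diam ⊕ ULift.{u} Bool → E at g
  rw [energy_tilde_eq, G.length_tilde hD]
  let A (i : Fin (G.diam + 1)) (v : V) : E := g (Sum.inl (.layer i v))
  have hA (i : Fin (G.diam + 1)) :
      δ ≤ (∑ a : G.Dart, ‖A i a.fst - A i a.snd‖ ^ q) / Fintype.card G.Dart := by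
    -- The potentials `layerDist` transfer the expansion hypothesis to each layer, as a map on G.
    refine hδ _ fun u v => ?_
    have h : (G.dist u v : ℝ) - G.dist u u ≤ M * ‖A i u - A i v‖ :=
      hg (G.layerDist u) (G.isPotential_layerDist hG u) rfl
        (Sum.inl (.layer i u)) (Sum.inl (.layer i v))
    rwa [dist_self, Nat.cast_zero, sub_zero] at h
  let a (i : Fin (G.diam + 1)) : E := (1 / Fintype.card V : ℝ) • ∑ v, A i v
  have hlayer (i : Fin G.diam) : ‖a i.succ - a i.castSucc‖ ^ q + κ * δ ≤
      ((∑ v, ‖A i.castSucc v - A i.succ v‖ ^ q) / Fintype.card V +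
        (∑ b : G.Dart, ‖A i.castSucc b.fst - A i.succ b.snd‖ ^ q) / Fintype.card G.Dart) / 2 :=
    le_trans (add_le_add_right (mul_le_mul_of_nonneg_left (hA i.succ) hκ) _)
      (G.norm_average_sub_rpow_add_le hd hq hE (A i.castSucc) (A i.succ))
  -- Every one of the diam G steps between layers gains κ δ. The layers have weight 1/9 in the
  -- energy, whence the gain κ δ / 9.
  have hmid : ((∑ i : Fin G.diam, ‖a i.succ - a i.castSucc‖) / G.diam) ^ q + κ * δ ≤
      (∑ i : Fin G.diam, ((∑ v, ‖A i.castSucc v - A i.succ v‖ ^ q) / Fintype.card V +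
        (∑ b : G.Dart, ‖A i.castSucc b.fst - A i.succ b.snd‖ ^ q) /
          Fintype.card G.Dart) / 2) / G.diam := by
    have h₁ := rpow_average_le (fun i : Fin G.diam => norm_nonneg (a i.succ - a i.castSucc)) hq
    have h₂ := Finset.sum_le_sum fun i (_ : i ∈ Finset.univ) => hlayer i
    rw [Finset.sum_add_distrib, Finset.sum_const, Finset.card_univ, nsmul_eq_mul] at h₂
    rw [Fintype.card_fin] at h₁ h₂
    refine (add_le_add_left h₁ _).trans ?_
    refine le_trans (le_of_eq ?_) (div_le_div_of_nonneg_right h₂ hD0.le)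
    rw [add_div, mul_div_cancel_left₀ _ hD0.ne']
  have hs := norm_sub_average_rpow_le hq hD0.le (g (Sum.inl .s)) (A 0)
  have ht := norm_sub_average_rpow_le hq hD0.le (g (Sum.inl .t)) (A (Fin.last _))
  have hfive := rpow_mean_five_le hq
    (x := ![‖g (Sum.inr ⟨false⟩) - g (Sum.inl .s)‖ / (3 * G.diam),
      ‖g (Sum.inl .s) - a 0‖ / G.diam, (∑ i : Fin G.diam, ‖a i.succ - a i.castSucc‖) / G.diam,
      ‖g (Sum.inl .t) - a (Fin.last _)‖ / G.diam,
      ‖g (Sum.inl .t) - g (Sum.inr ⟨true⟩)‖ / (3 * G.diam)])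
    (fun i => by fin_cases i <;> simp <;> positivity)
  simp only [Matrix.cons_val] at hfive
  have htri : ‖g (Sum.inr ⟨false⟩) - g (Sum.inr ⟨true⟩)‖ ≤
      ‖g (Sum.inr ⟨false⟩) - g (Sum.inl .s)‖ + ‖g (Sum.inl .s) - a 0‖ +
      (∑ i : Fin G.diam, ‖a i.succ - a i.castSucc‖) + ‖g (Sum.inl .t) - a (Fin.last _)‖ +
      ‖g (Sum.inl .t) - g (Sum.inr ⟨true⟩)‖ := by
    have h₀ := norm_sub_last_le_sum a
    have h₁ := norm_sub_le_norm_sub_add_norm_sub (g (Sum.inr ⟨false⟩)) (g (Sum.inl .s))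
      (g (Sum.inr ⟨true⟩))
    have h₂ := norm_sub_le_norm_sub_add_norm_sub (g (Sum.inl .s)) (a 0) (g (Sum.inr ⟨true⟩))
    have h₃ := norm_sub_le_norm_sub_add_norm_sub (a 0) (a (Fin.last _)) (g (Sum.inr ⟨true⟩))
    have h₄ := norm_sub_le_norm_sub_add_norm_sub (a (Fin.last _)) (g (Sum.inl .t))
      (g (Sum.inr ⟨true⟩))
    rw [norm_sub_rev (a (Fin.last _)) (g (Sum.inl .t))] at h₄
    linarith
  have hbase : ‖g (Sum.inr ⟨false⟩) - g (Sum.inr ⟨true⟩)‖ / ((9 * G.diam : ℝ≥0) : ℝ) ≤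
      1 / 3 * (‖g (Sum.inr ⟨false⟩) - g (Sum.inl .s)‖ / (3 * G.diam)) +
      1 / 9 * (‖g (Sum.inl .s) - a 0‖ / G.diam) +
      1 / 9 * ((∑ i : Fin G.diam, ‖a i.succ - a i.castSucc‖) / G.diam) +
      1 / 9 * (‖g (Sum.inl .t) - a (Fin.last _)‖ / G.diam) +
      1 / 3 * (‖g (Sum.inl .t) - g (Sum.inr ⟨true⟩)‖ / (3 * G.diam)) := by
    push_cast
    rw [div_le_iff₀ (by positivity)]
    refine htri.trans_eq ?_
    field_simp
    ring
  have hfin := (Real.rpow_le_rpow (by positivity) hbase (by linarith)).trans hfive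
  change (‖g (Sum.inr ⟨false⟩) - g (Sum.inr ⟨true⟩)‖ / ((9 * G.diam : ℝ≥0) : ℝ)) ^ q + _ ≤ _
  linarith [hmid, hs, ht, hfin]

end SimpleGraph

/-! ### From energy to distortion -/

theorem edist_le_lipConst_mul {X Y : Type*} [PseudoEMetricSpace X] [PseudoEMetricSpace Y]
    {f : X → Y} (hL : lipConst f ≠ ∞) {x y : X} (hxy : edist x y ≠ ∞) :
    edist (f x) (f y) ≤ lipConst f * edist x y := by
  by_cases h : x = y
  · simp [h]
  have h1 : edist (f x) (f y) / edist x y ≤ lipConst f :=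
    le_iSup_of_le x (le_iSup_of_le y (le_iSup_of_le h le_rfl))
  exact (ENNReal.div_le_iff_le_mul (Or.inr hL) (Or.inl hxy)).1 h1

theorem edist_le_invLipConst_mul {X Y : Type*} [PseudoEMetricSpace X] [PseudoEMetricSpace Y]
    {f : X → Y} (hM : invLipConst f ≠ ∞) {x y : X} (hxy : edist (f x) (f y) ≠ ∞) :
    edist x y ≤ invLipConst f * edist (f x) (f y) := by
  by_cases h : x = y
  · simp [h]
  have h1 : edist x y / edist (f x) (f y) ≤ invLipConst f :=
    le_iSup_of_le x (le_iSup_of_le y (le_iSup_of_le h le_rfl))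
  exact (ENNReal.div_le_iff_le_mul (Or.inr hM) (Or.inl hxy)).1 h1

namespace STGraph

theorem ofReal_le_distortion {H : STGraph.{u}} [Fintype H.E] {U : H.E → ℝ}
    (hU : ∀ e, 0 ≤ U e) (hU1 : ∑ e, U e = 1) {E : Type*} [NormedAddCommGroup E] {q B : ℝ}
    (hq : 0 < q) (hB : 0 ≤ B)
    (hE : ∀ M : ℝ, 0 < M → ∀ f : H.V → E, H.Expands M f → (B / M) ^ q ≤ H.energy U q f)
    (hpot : ∃ φ, H.IsPotential φ ∧ φ H.s < φ H.t) (hedge : ∃ e, H.src e ≠ H.tgt e)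
    {f : H.V → E} (hf : Function.Injective f) : ENNReal.ofReal B ≤ distortion f := by
  have hlen (e : H.E) : edist (H.src e) (H.tgt e) ≤ H.len e := pathDist_le (H.hasWalk_edge e)
  -- Neither Lipschitz constant may vanish, since ∞ · 0 = 0 would spoil the cases where the other is
  -- infinite.
  have hL0 : lipConst f ≠ 0 := by
    obtain ⟨e, he⟩ := hedge
    intro h0
    have h := edist_le_lipConst_mul (f := f) (by simp [h0])
      ((hlen e).trans_lt ENNReal.coe_lt_top).ne
    rw [h0, zero_mul, nonpos_iff_eq_zero, edist_eq_zero] at h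
    exact he (hf h)
  have hM0 : invLipConst f ≠ 0 := by
    obtain ⟨φ, hφ, hst⟩ := hpot
    intro h0
    have h := edist_le_invLipConst_mul (f := f) (by simp [h0]) (edist_ne_top (f H.s) (f H.t))
    rw [h0, zero_mul] at h
    have h2 := (hφ.ofReal_le_pathDist H.s H.t).trans h
    rw [nonpos_iff_eq_zero, ENNReal.ofReal_eq_zero] at h2
    linarith
  rw [distortion]
  by_cases hL : lipConst f = ∞
  · rw [hL, ENNReal.top_mul hM0]
    exact le_top
  by_cases hM : invLipConst f = ∞
  · rw [hM, ENNReal.mul_top hL0]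
    exact le_top
  have hM' : 0 < (invLipConst f).toReal := ENNReal.toReal_pos hM0 hM
  have hexp : H.Expands (invLipConst f).toReal f := by
    intro φ hφ x y
    have h := (hφ.ofReal_le_pathDist x y).trans
      (edist_le_invLipConst_mul hM (edist_ne_top (f x) (f y)))
    rw [edist_dist, dist_eq_norm, ← ENNReal.ofReal_toReal hM, ← ENNReal.ofReal_mul hM'.le] at h
    exact (ENNReal.ofReal_le_ofReal_iff (by positivity)).1 h
  have hlip (e : H.E) : ‖f (H.src e) - f (H.tgt e)‖ ≤ (lipConst f).toReal * H.len e := by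
    have h := (edist_le_lipConst_mul hL ((hlen e).trans_lt ENNReal.coe_lt_top).ne).trans
      (mul_le_mul_right (hlen e) _)
    rw [edist_dist, dist_eq_norm] at h
    have h2 := (ENNReal.ofReal_le_iff_le_toReal (ENNReal.mul_ne_top hL ENNReal.coe_ne_top)).1 h
    rwa [ENNReal.toReal_mul, ENNReal.coe_toReal] at h2
  -- (B / M)^q ≤ energy ≤ L^q, hence B ≤ L M.
  have h := (hE _ hM' f hexp).trans (energy_le hU hU1 hq.le ENNReal.toReal_nonneg hlip)
  have h2 := (Real.rpow_le_rpow_iff (by positivity) ENNReal.toReal_nonneg hq).1 h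
  rw [div_le_iff₀ hM'] at h2
  refine ENNReal.ofReal_le_of_le_toReal ?_
  rwa [ENNReal.toReal_mul]

theorem exists_isPotential_power {G : STGraph.{u}} {ψ : G.V → ℝ} (hψ : G.IsHeight ψ)
    (hL : 0 < G.length) (k : ℕ) :
    ∃ φ, (G.power k).IsPotential φ ∧ φ (G.power k).s < φ (G.power k).t := by
  induction k with
  | zero =>
    refine ⟨fun b : ULift.{u} Bool => if b.down then 1 else 0, fun e => ?_, ?_⟩
    · simp [power, singleEdge]
    · simp [power, singleEdge]
  | succ k ih =>
    obtain ⟨φ, hφ, h⟩ := ih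
    obtain ⟨φ', hφ', h'⟩ := hφ.exists_extension hψ hL
    exact ⟨φ', hφ', (h' _).trans_lt (h.trans_eq (h' _).symm)⟩

end STGraph

theorem SimpleGraph.exists_edge_power_tilde {V : Type u} (G : SimpleGraph V) (k : ℕ) :
    ∃ e, (G.tilde.power k).src e ≠ (G.tilde.power k).tgt e := by
  induction k with
  | zero => exact ⟨PUnit.unit, by simp [STGraph.power, STGraph.singleEdge]⟩
  | succ k ih =>
    obtain ⟨e, -⟩ := ih
    refine ⟨(e, Sum.inr ⟨false⟩), fun h => ?_⟩
    have hs : (Sum.inl .s : G.tilde.V) ≠ G.tilde.s := Sum.inl_ne_inr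
    have ht : (Sum.inl .s : G.tilde.V) ≠ G.tilde.t := Sum.inl_ne_inr
    have h1 := STGraph.copyVertex_s (G.tilde.power k) G.tilde e
    have h2 : STGraph.copyVertex (G.tilde.power k) G.tilde e (Sum.inl .s) =
        Sum.inr (e, ⟨Sum.inl .s, hs, ht⟩) := (dif_neg hs).trans (dif_neg ht)
    exact Sum.inl_ne_inr (h1.symm.trans (Eq.trans h h2))

/-! ### Counting the vertices of the powers -/

namespace STGraph

theorem card_power_E (G : STGraph.{u}) (k : ℕ) : Nat.card (G.power k).E = Nat.card G.E ^ k := by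
  induction k with
  | zero => exact Nat.card_unique (α := PUnit)
  | succ k ih =>
    rw [pow_succ, ← ih]
    exact Nat.card_prod (G.power k).E G.E

variable (G : STGraph.{u}) [Finite G.V] [Finite G.E]

theorem finite_power (k : ℕ) : Finite (G.power k).V ∧ Finite (G.power k).E := by
  induction k with
  | zero => exact ⟨inferInstanceAs (Finite (ULift Bool)), inferInstanceAs (Finite PUnit)⟩
  | succ k ih =>
    obtain ⟨_, _⟩ := ih
    exact ⟨inferInstanceAs (Finite (CompV (G.power k) G)),
      inferInstanceAs (Finite ((G.power k).E × G.E))⟩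

theorem card_power_succ_V (k : ℕ) : Nat.card (G.power (k + 1)).V =
    Nat.card (G.power k).V + Nat.card G.E ^ k * Nat.card {v : G.V // v ≠ G.s ∧ v ≠ G.t} := by
  obtain ⟨_, _⟩ := G.finite_power k
  rw [← card_power_E, ← Nat.card_prod]
  exact Nat.card_sum

/-- The 2 added in `hV` pays for the old vertices: 2 B^k + B^k I = B^k (I + 2) ≤ B^(k + 1), where I
is the number of interior vertices of G. -/
theorem card_power_V_le {B : ℕ} (hE : Nat.card G.E ≤ B)
    (hV : Nat.card {v : G.V // v ≠ G.s ∧ v ≠ G.t} + 2 ≤ B) (k : ℕ) :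
    Nat.card (G.power k).V ≤ 2 * B ^ k := by
  induction k with
  | zero =>
    change Nat.card (ULift Bool) ≤ _
    simp
  | succ k ih =>
    rw [card_power_succ_V]
    have h1 : Nat.card G.E ^ k * Nat.card {v : G.V // v ≠ G.s ∧ v ≠ G.t} ≤
        B ^ k * Nat.card {v : G.V // v ≠ G.s ∧ v ≠ G.t} := by gcongr
    have h2 : B ^ k * (Nat.card {v : G.V // v ≠ G.s ∧ v ≠ G.t} + 2) ≤ B ^ k * B := by gcongr
    rw [pow_succ]
    nlinarith

theorem pow_le_card_power_V {b : ℕ} (hE : b ≤ Nat.card G.E)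
    (hV : b ≤ Nat.card {v : G.V // v ≠ G.s ∧ v ≠ G.t}) (k : ℕ) :
    b ^ (k + 1) ≤ Nat.card (G.power (k + 1)).V := by
  rw [card_power_succ_V, pow_succ]
  exact (Nat.mul_le_mul (Nat.pow_le_pow_left hE k) hV).trans (Nat.le_add_left _ _)

end STGraph

namespace SimpleGraph

variable {V : Type u}

/-- The vertices of the stretched graph, as a disjoint union. -/
def stretchedVertexEquiv (V : Type u) (D : ℕ) :
    StretchedVertex V D ≃ Bool ⊕ (Fin (D + 1) × V) where
  toFun
    | .s => Sum.inl false
    | .t => Sum.inl true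
    | .layer i v => Sum.inr (i, v)
  invFun
    | Sum.inl false => .s
    | Sum.inl true => .t
    | Sum.inr (i, v) => .layer i v
  left_inv x := by cases x <;> rfl
  right_inv x := by rcases x with (_ | _) | _ <;> rfl

variable (G : SimpleGraph V)

instance [Finite V] (D : ℕ) : Finite (StretchedVertex V D) :=
  Finite.of_equiv _ (stretchedVertexEquiv V D).symm

instance [Finite V] : Finite G.tilde.V :=
  inferInstanceAs (Finite (StretchedVertex V G.diam ⊕ ULift.{u} Bool))

theorem card_tilde_V [Fintype V] : Nat.card G.tilde.V = (G.diam + 1) * Fintype.card V + 4 := by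
  have h : Nat.card (StretchedVertex V G.diam ⊕ ULift.{u} Bool) =
      (G.diam + 1) * Fintype.card V + 4 := by
    rw [Nat.card_sum, Nat.card_congr (stretchedVertexEquiv V G.diam)]
    simp
    ring
  exact h

theorem card_le_card_interior_tilde [Fintype V] :
    Fintype.card V ≤ Nat.card {v : G.tilde.V // v ≠ G.tilde.s ∧ v ≠ G.tilde.t} := by
  rw [← Nat.card_eq_fintype_card]
  let f (v : V) : {v : G.tilde.V // v ≠ G.tilde.s ∧ v ≠ G.tilde.t} :=
    ⟨Sum.inl (.layer 0 v), Sum.inl_ne_inr, Sum.inl_ne_inr⟩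
  refine Nat.card_le_card_of_injective f fun v w h => ?_
  have h2 : (Sum.inl (.layer 0 v) : StretchedVertex V G.diam ⊕ ULift.{u} Bool) =
    Sum.inl (.layer 0 w) := congrArg Subtype.val h
  simpa using h2

theorem diam_lt_card [Fintype V] (hG : G.Connected) : G.diam < Fintype.card V := by
  have : Nonempty V := hG.nonempty
  obtain ⟨u, v, h⟩ := G.exists_dist_eq_diam
  obtain ⟨w, hw, hl⟩ := hG.exists_path_of_dist u v
  rw [← h, ← hl]
  exact hw.length_lt

variable [Fintype V] [DecidableRel G.Adj]

theorem card_tilde_E : Nat.card G.tilde.E = 2 * Fintype.card V +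
    (G.diam + 1) * Fintype.card G.edgeSet + G.diam * Fintype.card V +
      G.diam * Fintype.card G.Dart + 2 := by
  have h : Nat.card (StretchedEdge G G.diam ⊕ ULift.{u} Bool) = 2 * Fintype.card V +
    (G.diam + 1) * Fintype.card G.edgeSet + G.diam * Fintype.card V +
      G.diam * Fintype.card G.Dart + 2 := by
    rw [Nat.card_sum, Nat.card_congr (G.stretchedEdgeEquiv G.diam), Nat.card_eq_fintype_card]
    simp only [Fintype.card_sum, Fintype.card_prod, Fintype.card_fin]
    simp
    ring
  exact h

theorem card_dart_le : Fintype.card G.Dart ≤ Fintype.card V ^ 2 := by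
  rw [sq, ← Fintype.card_prod]
  exact Fintype.card_le_of_injective (fun a : G.Dart => a.toProd) fun a b h => Dart.ext _ _ h

theorem card_edgeSet_le : Fintype.card G.edgeSet ≤ Fintype.card V ^ 2 := by
  refine le_trans ?_ G.card_dart_le
  refine Fintype.card_le_of_surjective (fun a : G.Dart => (⟨a.edge, a.edge_mem⟩ : G.edgeSet)) ?_
  rintro ⟨e, he⟩
  induction e using Sym2.ind with
  | _ u v => exact ⟨⟨(u, v), he⟩, rfl⟩

theorem card_power_tilde_bounds (hG : G.Connected) (hm : 2 ≤ Fintype.card V) (k : ℕ) :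
    Fintype.card V ^ (k + 1) ≤ Nat.card (G.tilde.power (k + 1)).V ∧
      Nat.card (G.tilde.power (k + 1)).V ≤ Fintype.card V ^ (7 * (k + 1)) := by
  have : Finite G.tilde.E := Finite.of_fintype _
  set m := Fintype.card V with hmdef
  have hD := G.diam_lt_card hG
  have hdart := G.card_dart_le
  have hedge := G.card_edgeSet_le
  rw [← hmdef] at hD hdart hedge
  have hE := G.card_tilde_E
  rw [← hmdef] at hE
  have hEle : Nat.card G.tilde.E ≤ m ^ 6 := by
    rw [hE]
    calc 2 * m + (G.diam + 1) * Fintype.card G.edgeSet + G.diam * m +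
          G.diam * Fintype.card G.Dart + 2
        ≤ 2 * m + m * m ^ 2 + m * m + m * m ^ 2 + 2 := by gcongr; exact hD
      _ ≤ 5 * m ^ 3 := by nlinarith [Nat.mul_le_mul hm hm, Nat.mul_le_mul (Nat.mul_le_mul hm hm) hm]
      _ ≤ 2 ^ 3 * m ^ 3 := by gcongr; norm_num
      -- Numerical factors are absorbed into powers of m ≥ 2. The exponent 7 consists of this 6 and
      -- one more for the factor 2 in `card_power_V_le`.
      _ ≤ m ^ 3 * m ^ 3 := by gcongr
      _ = m ^ 6 := by ring
  have hVle : Nat.card {v : G.tilde.V // v ≠ G.tilde.s ∧ v ≠ G.tilde.t} + 2 ≤ m ^ 6 := by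
    have h1 := Nat.card_le_card_of_injective
      (Subtype.val : {v : G.tilde.V // v ≠ G.tilde.s ∧ v ≠ G.tilde.t} → G.tilde.V)
      Subtype.val_injective
    rw [card_tilde_V, ← hmdef] at h1
    calc _ ≤ (G.diam + 1) * m + 4 + 2 := by gcongr
      _ ≤ m * m + 4 + 2 := by gcongr; exact hD
      _ ≤ 2 ^ 4 * m ^ 2 := by nlinarith
      _ ≤ m ^ 4 * m ^ 2 := by gcongr
      _ = m ^ 6 := by ring
  constructor
  · refine G.tilde.pow_le_card_power_V ?_ G.card_le_card_interior_tilde k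
    rw [hE, hmdef]
    nlinarith
  · refine (G.tilde.card_power_V_le hEle hVle (k + 1)).trans ?_
    calc 2 * (m ^ 6) ^ (k + 1) ≤ m ^ (k + 1) * (m ^ 6) ^ (k + 1) := by
          gcongr
          exact hm.trans (Nat.le_self_pow (by omega) m)
      _ = m ^ (7 * (k + 1)) := by
          rw [← pow_mul, ← pow_add]
          congr 1
          ring

end SimpleGraph

/-! ### Assembling the bounds -/

/-- Since k^(1/q) ℓ = ℓ^(1 - 1/q) (k ℓ)^(1/q), it suffices that T and k ℓ are comparable; here T
stands for log N and ℓ for log m. -/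
theorem rpow_mul_bounds {k ℓ T q : ℝ} (hk : 0 ≤ k) (hℓ : 0 < ℓ) (hq : 1 ≤ q) (h₁ : k * ℓ ≤ T)
    (h₂ : T ≤ 7 * (k * ℓ)) :
    1 / 7 * (ℓ ^ (1 - 1 / q) * T ^ (1 / q)) ≤ k ^ (1 / q) * ℓ ∧
      k ^ (1 / q) * ℓ ≤ ℓ ^ (1 - 1 / q) * T ^ (1 / q) := by
  have hq0 : 0 < q := by linarith
  have hkl : 0 ≤ k * ℓ := by positivity
  have e : k ^ (1 / q) * ℓ = ℓ ^ (1 - 1 / q) * (k * ℓ) ^ (1 / q) := by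
    rw [Real.mul_rpow hk hℓ.le, Real.rpow_sub hℓ, Real.rpow_one]
    field_simp
  rw [e]
  constructor
  · have h3 : T ^ (1 / q) ≤ 7 * (k * ℓ) ^ (1 / q) := by
      calc T ^ (1 / q) ≤ (7 * (k * ℓ)) ^ (1 / q) :=
            Real.rpow_le_rpow (hkl.trans h₁) h₂ (by positivity)
        _ = 7 ^ (1 / q) * (k * ℓ) ^ (1 / q) := Real.mul_rpow (by norm_num) hkl
        _ ≤ 7 * (k * ℓ) ^ (1 / q) := by
          gcongr
          exact Real.rpow_le_self_of_one_le (by norm_num) ((div_le_one hq0).2 hq)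
    have h4 : 0 < ℓ ^ (1 - 1 / q) := by positivity
    nlinarith
  · gcongr

/-- The factor of the distortion bound that depends on `p`. -/
noncomputable def lpDistortionConst (p : ℝ) : ℝ := (lpConvexityConst p / 9) ^ (1 / max p 2) / p

theorem lpDistortionConst_pos {p : ℝ} (hp : 1 < p) : 0 < lpDistortionConst p := by
  have := lpConvexityConst_pos hp
  rw [lpDistortionConst]
  positivity

namespace SimpleGraph

variable {V : Type u} [Fintype V] [DecidableEq V] (G : SimpleGraph V) [DecidableRel G.Adj]

theorem ofReal_le_distortion_power_tilde {d : ℕ} (hd : G.IsRegularOfDegree d) (hd0 : 1 ≤ d)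
    (hm : 2 ≤ Fintype.card V) {μ₀ η p : ℝ} (hμ₀ : 0 < μ₀) (hμ : μ₀ ≤ G.mu₂) (hη : 0 < η)
    (hη1 : η ≤ 1) (hηd : η * (2 * d) ≤ μ₀) (hp : 1 < p) (k : ℕ)
    {Ω : Type w} [MeasurableSpace Ω] {μ : MeasureTheory.Measure Ω} [Fact (1 ≤ ENNReal.ofReal p)]
    {f : (G.tilde.power k).V → MeasureTheory.Lp ℝ (ENNReal.ofReal p) μ}
    (hf : Function.Injective f) :
    ENNReal.ofReal (η / (8 * Real.log (d + 1)) *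
      (lpDistortionConst p * (k : ℝ) ^ (1 / max p 2) * Real.log (Fintype.card V))) ≤
      distortion f := by
  have hconn := G.connected_of_mu₂_pos (hμ₀.trans_le hμ)
  have : Nontrivial V := Fintype.one_lt_card_iff_nontrivial.1 hm
  have hneD : Nonempty G.Dart := by
    refine Fintype.card_pos_iff.1 ?_
    rw [G.card_dart_of_regular hd]
    positivity
  have hD : 1 ≤ G.diam := Nat.one_le_iff_ne_zero.2 (connected_iff_diam_ne_zero.1 hconn)
  have hL : 0 < G.tilde.length := by
    rw [G.length_tilde hD]
    positivity
  have hd0' : (1 : ℝ) ≤ d := by exact_mod_cast hd0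
  have hp0 : 0 < p := by linarith
  have hlogd : 0 < Real.log ((d : ℝ) + 1) := Real.log_pos (by linarith)
  have hlogm : 0 ≤ Real.log (Fintype.card V) := Real.log_natCast_nonneg _
  have hκ := lpConvexityConst_pos hp
  set κ := lpConvexityConst p with hκdef
  set q := max p 2
  have hq : 1 ≤ q := one_le_two.trans (le_max_right _ _)
  have hq0 : 0 < q := by linarith
  set Λ := Real.log (Fintype.card V) / (4 * Real.log (d + 1)) with hΛ
  have hΛ0 : 0 ≤ Λ := by positivity
  have hK : 0 < 2 * p / η := by positivity
  have hgain (M : ℝ) (hM : 0 < M) : G.tilde.Gains (MeasureTheory.Lp ℝ (ENNReal.ofReal p) μ)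
      G.tildeWeight q M (κ * (Λ / (2 * p / η * M)) ^ q / 9) :=
    G.gains_tilde hd hconn hD hq hκ.le (norm_midpoint_rpow_le hp) fun h hh =>
      G.rpow_le_average_dart hd hd0 hm hconn hp (le_max_left _ _) hK hM h
        (G.sum_norm_sub_rpow_le hd hμ₀ hμ hη hη1 hηd hp h) hh
  obtain ⟨-, _, U, hU, hU1, hpow⟩ := STGraph.exists_energy_power_ge
    (E := MeasureTheory.Lp ℝ (ENNReal.ofReal p) μ) (q := q) G.tildeWeight_nonneg
    (G.sum_tildeWeight hD) (G.isHeight_tildeHeight hD) hL (G.len_tilde_pos hD) k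
  have hC := lpDistortionConst_pos hp
  refine STGraph.ofReal_le_distortion hU hU1 hq0 (by positivity) (fun M hM f hf => ?_)
    (STGraph.exists_isPotential_power (G.isHeight_tildeHeight hD) hL k)
    (G.exists_edge_power_tilde k) hf
  refine le_trans (le_of_eq ?_) (hpow M _ (hgain M hM) f hf)
  -- The q-th root of k κ (Λ / (K M))^q / 9 with K = 2 p / η; the 8 is the 4 in Λ times the 2 in K.
  have e : η / (8 * Real.log (d + 1)) * (lpDistortionConst p * (k : ℝ) ^ (1 / q) *
      Real.log (Fintype.card V)) / M =
      (k : ℝ) ^ (1 / q) * (κ / 9) ^ (1 / q) * (Λ / (2 * p / η * M)) := by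
    rw [lpDistortionConst, ← hκdef, hΛ]
    field_simp
    ring
  have hroot (x : ℝ) (hx : 0 ≤ x) : (x ^ (1 / q)) ^ q = x := by
    rw [← Real.rpow_mul hx, one_div_mul_cancel hq0.ne', Real.rpow_one]
  rw [e, Real.mul_rpow (by positivity) (by positivity),
    Real.mul_rpow (by positivity) (by positivity), hroot _ (by positivity), hroot _ (by positivity)]
  ring

end SimpleGraph

theorem mainTheorem2 :
    ∃ C : ℝ → ℝ, (∀ p : ℝ, 1 < p → 0 < C p) ∧
    ∃ a b : ℝ, 0 < a ∧ 0 < b ∧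
    ∀ (d : ℕ) (μ₀ : ℝ), 0 < μ₀ → ∃ c : ℝ, 0 < c ∧
    ∀ (V : Type u) [Fintype V] [DecidableEq V] (G : SimpleGraph V) [DecidableRel G.Adj],
      G.IsRegularOfDegree d → G.VertexTransitive → μ₀ ≤ G.mu₂ →
    ∀ (p : ℝ), 1 < p → ∀ (k m N : ℕ) (q : ℝ),
      m = Fintype.card V → N = Nat.card (G.tilde.power k).V → q = max p 2 →
      ENNReal.ofReal (c * (C p * (k : ℝ) ^ (1 / q) * Real.log m)) ≤
          lpDistortion.{u, w} p (G.tilde.power k).V ∧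
      (1 ≤ k →
        a * (C p * Real.log m ^ (1 - 1 / q) * Real.log N ^ (1 / q)) ≤
            C p * (k : ℝ) ^ (1 / q) * Real.log m ∧
        C p * (k : ℝ) ^ (1 / q) * Real.log m ≤
            b * (C p * Real.log m ^ (1 - 1 / q) * Real.log N ^ (1 / q))) := by
  refine ⟨lpDistortionConst, fun p hp => lpDistortionConst_pos hp, 1 / 7, 1, by norm_num, one_pos,
    fun d μ₀ hμ₀ => ?_⟩
  -- The constants are fixed before d ≥ 1 is known. So d + 1 replaces d here and log (d + 1) below,
  -- both of which vanish at d = 0.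
  let η : ℝ := min 1 (μ₀ / (2 * (d + 1)))
  have hη : 0 < η := lt_min one_pos (by positivity)
  refine ⟨η / (8 * (d + 1)), by positivity, ?_⟩
  intro V _ _ G _ hd _ hμ p hp k m N q hm hN hq
  subst hm hN hq
  have hconn := G.connected_of_mu₂_pos (hμ₀.trans_le hμ)
  -- The default value 0 of `mu₂` below two vertices contradicts 0 < μ₀ ≤ μ₂.
  have hcard : 2 ≤ Fintype.card V := by
    by_contra h
    rw [SimpleGraph.mu₂, dif_neg h] at hμ
    linarith
  have : Nontrivial V := Fintype.one_lt_card_iff_nontrivial.1 hcard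
  have hd0 : 1 ≤ d := by
    obtain ⟨v⟩ := hconn.nonempty
    rw [← hd v]
    exact hconn.preconnected.degree_pos_of_nontrivial v
  have hd0' : (1 : ℝ) ≤ d := by exact_mod_cast hd0
  have hC := lpDistortionConst_pos hp
  have hq : 1 ≤ max p 2 := one_le_two.trans (le_max_right _ _)
  have hlogm : 0 < Real.log (Fintype.card V) := Real.log_pos (by exact_mod_cast hcard)
  constructor
  · have : Fact (1 ≤ ENNReal.ofReal p) := ⟨by simpa using hp.le⟩
    have hηd : η * (2 * d) ≤ μ₀ := by
      have h1 : η ≤ μ₀ / (2 * (d + 1)) := min_le_right _ _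
      rw [le_div_iff₀ (by positivity)] at h1
      nlinarith
    have hlogd : 0 < Real.log ((d : ℝ) + 1) := Real.log_pos (by linarith)
    have hlogd' : Real.log ((d : ℝ) + 1) ≤ d + 1 := by
      linarith [Real.log_le_sub_one_of_pos (show (0 : ℝ) < d + 1 by positivity)]
    refine le_iInf fun Ω => le_iInf fun _ => le_iInf fun μ => le_iInf fun f => le_iInf fun hf => ?_
    refine le_trans (ENNReal.ofReal_le_ofReal ?_) (G.ofReal_le_distortion_power_tilde hd hd0 hcard
      hμ₀ hμ hη (min_le_left _ _) hηd hp k hf)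
    gcongr
  · intro hk
    obtain ⟨j, rfl⟩ : ∃ j, k = j + 1 := ⟨k - 1, by omega⟩
    obtain ⟨h₁, h₂⟩ := G.card_power_tilde_bounds hconn hcard j
    set N := Nat.card (G.tilde.power (j + 1)).V
    have hN0 : 0 < N := (by positivity : 0 < Fintype.card V ^ (j + 1)).trans_le h₁
    have l₁ : ((j + 1 : ℕ) : ℝ) * Real.log (Fintype.card V) ≤ Real.log N := by
      rw [← Real.log_pow]
      exact Real.log_le_log (by positivity) (by exact_mod_cast h₁)
    have l₂ : Real.log N ≤ 7 * (((j + 1 : ℕ) : ℝ) * Real.log (Fintype.card V)) := by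
      have h := Real.log_le_log (by positivity)
        (show (N : ℝ) ≤ (Fintype.card V : ℝ) ^ (7 * (j + 1)) by exact_mod_cast h₂)
      rw [Real.log_pow] at h
      push_cast at h ⊢
      linarith
    obtain ⟨b₁, b₂⟩ := rpow_mul_bounds (Nat.cast_nonneg (j + 1)) hlogm hq l₁ l₂
    constructor
    · calc _ = lpDistortionConst p * (1 / 7 * (Real.log (Fintype.card V) ^ (1 - 1 / max p 2) *
            Real.log N ^ (1 / max p 2))) := by ring
        _ ≤ lpDistortionConst p * (((j + 1 : ℕ) : ℝ) ^ (1 / max p 2) *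
            Real.log (Fintype.card V)) := by gcongr
        _ = _ := by ring
    · calc _ = lpDistortionConst p * (((j + 1 : ℕ) : ℝ) ^ (1 / max p 2) *
            Real.log (Fintype.card V)) := by ring
        _ ≤ lpDistortionConst p * (Real.log (Fintype.card V) ^ (1 - 1 / max p 2) *
            Real.log N ^ (1 / max p 2)) := by gcongr
        _ = _ := by ring
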